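/- Setting. Let $1\le M\le N$ and $N\ge 2$. Agents $k\in\{1,\dots,M\}$ repeatedly choose among arms $i\in\{1,\dots,N\}$ and communicate over a connected undirected graph on the agents with Laplacian $\mathcal L$ and maximum degree $d_{\max}$. Let $\kappa\in(0,1]$ and $P=I_M-\frac{\kappa}{d_{\max}}\mathcal L$ (with $P=1$ if $M=1$), let $\lambda_1=1\ge\lambda_2\ge\dots\ge\lambda_M$ be the eigenvalues of $P$, assume $\lambda_M>-1$, and let $\mathbf u_1=\mathbf 1_M/\sqrt M,\mathbf u_2,\dots,\mathbf u_M$ be a corresponding orthonormal basis of eigenvectors, $\mathbf u_p=(u_p^1,\dots,u_p^M)$. Put $$\epsilon_n=\sqrt M\sum_{p=2}^M\frac{|\lambda_p|}{1-|\lambda_p|},\qquad \epsilon_c^k=M\sum_{p=1}^M\sum_{j=2}^M\frac{|\lambda_p\lambda_j|}{1-|\lambda_p\lambda_j|}\,a_{pj}(k),$$ where, with $\nu^{+}_{pj}=\sum_{d}\max(u_p^du_j^d,0)$ and $\nu^{-}_{pj}=\sum_{d}\min(u_p^du_j^d,0)$, $a_{pj}(k)$ equals $\nu^+_{pj}u_p^ku_j^k$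 if $\lambda_p\lambda_j\ge0$ and $u_p^ku_j^k\ge0$; $\nu^-_{pj}u_p^ku_j^k$ if $\lambda_p\lambda_j\ge0$ and $u_p^ku_j^k\le0$; and $\max(|\nu^-_{pj}|,\nu^+_{pj})\,|u_p^ku_j^k|$ if $\lambda_p\lambda_j<0$. Rewards. Arm $i$ has a reward distribution $p_i$ with mean $m_i$ that is sub-Gaussian with parameter $\sigma_g>0$: $\ln\int e^{\beta x}\,p_i(dx)\le m_i\beta+\sigma_g^2\beta^2/2$ for all $\beta\in\mathbb R$. The means are pairwise different; let $b^1,\dots,b^N$ be the arms with $m_{b^1}>\dots>m_{b^N}$, and let $\Delta_{\min}=\min_{i\ne j}|m_i-m_j|$. At each time $t=1,2,\dots$ the realized reward $r_i^k(t)$ of arm $i$ for agent $k$ has distribution $p_i$; the rewards at time $t$ are independent of the past $\mathcal F_{t-1}$, and for each arm they are independent across the agents. The reward model is the constrained one: agents that select the same arm at the same time receive no reward, but they still observe the value of the reward and use it in their estimates. Algorithm (coop-UCB2-selective-learning). Let $i^k(t)$ be the arm selected by agent $k$ at time $t$; it is determined by the information in $\mathcal F_{t-1}$. The estimates are $\hat{\mathbf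 n}_i(0)=\hat{\mathbf s}_i(0)=0$, $\hat{\mathbf n}_i(t)=P(\hat{\mathbf n}_i(t-1)+\boldsymbol\xi_i(t))$ and $\hat{\mathbf s}_i(t)=P(\hat{\mathbf s}_i(t-1)+\mathbf r_i(t))$, where $\boldsymbol\xi_i(t)$ and $\mathbf r_i(t)$ have the entries $\mathbf 1(i^k(t)=i)$ and $r_i^k(t)\mathbf 1(i^k(t)=i)$, $k=1,\dots,M$; and $\hat\mu_i^k=\hat s_i^k/\hat n_i^k$. Let $\gamma>1$, $\eta\in(0,4)$, $G(\eta)=1-\eta^2/16$, let $f:[1,\infty)\to[0,\infty)$ be strictly increasing with $f(t)/\ln t\to0$ as $t\to\infty$, and $$C_i^k(t)=\sigma_g\sqrt{\frac{2\gamma}{G(\eta)}\cdot\frac{\hat n_i^k(t)+f(t)}{M\hat n_i^k(t)}\cdot\frac{\ln t}{\hat n_i^k(t)}},\qquad Q_i^k=\hat\mu_i^k+C_i^k,\qquad W_i^k=\hat\mu_i^k-C_i^k$$ (with $Q_i^k(t)=+\infty$ and $W_i^k(t)=-\infty$ if $\hat n_i^k(t)=0$). For $t\le N$ each agent samples each arm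 once in round-robin order, agent $k$ beginning with arm $k$. For $t>N$, agent $k$ forms a set $\mathcal O_k(t)$ of $k$ arms with the $k$ highest values of $Q_i^k(t-1)$ and selects an arm of $\mathcal O_k(t)$ with the minimum value of $W_i^k(t-1)$; ties are broken arbitrarily. Theorem (upper bound on incorrect selections). A selection of arm $i$ by agent $k$ is incorrect if $i\ne b^k$. Let $\bar n_i^k(T)$ be the number of incorrect selections of arm $i$ by agent $k$ until time $T$, and let $k^i$ be the agent $k$ with $b^k=i$ (with $k^i=0$ if there is none). Assume that $f$ takes the values $\epsilon_c^1,\dots,\epsilon_c^M$, and let $t_k^\dagger=f^{-1}(\epsilon_c^k)\ge1$. Then for every arm $i$ and every $T\ge1$ (the first term on the right being read as $0$ for $T=1$) $$\sum_{k\ne k^i}\mathbb E\big[\bar n_i^k(T)\big]\le\frac{4\sigma_g^2\gamma}{\Delta_{\min}^2G(\eta)}\left(1+\sqrt{1+\frac{\Delta_{\min}^2MG(\eta)}{2\sigma_g^2\gamma}\,\frac{f(T)}{\ln T}}\right)\ln T+\bar L,$$ where $$\bar L=\sum_{k=1}^M(t_k^\dagger-1)+M(1+\epsilon_n)+1+\frac{2M(N+1)}{\ln(1+\eta)}\left(\frac1{(\gamma-1)^2}+\frac{\gamma\ln\big((1+\epsilon_n)(1+\eta)\big)}{\gamma-1}+1\right)$$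 does not depend on $T$. -/

import Mathlib

open MeasureTheory ProbabilityTheory

noncomputable section

namespace CoopBandit

/-! Conventions. Agents are `k : Fin M` and arms are `i : Fin N`, both counted from `0`, so agent `k`
targets the `(k+1)`-th best arm. Time is `t = 1, 2, 3, …`; `arm t k` is the arm selected by agent `k`
at time `t`, and `r t k i` is the realized reward of arm `i` for agent `k` at time `t`. -/

/-! ### Sub-Gaussian distributions -/

/-- The probability distribution `p` on `ℝ` has mean `m` and is sub-Gaussian with parameter `σ`:
its cumulant generating function is finite and at most `m β + σ² β² / 2`. -/
def IsSubGaussian (p : Measure ℝ) (m σ : ℝ) : Prop :=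
  ∫ x, x ∂p = m ∧
  ∀ β : ℝ, Integrable (fun x => Real.exp (β * x)) p ∧
    cgf id p β ≤ m * β + σ ^ 2 * β ^ 2 / 2

/-! ### The communication graph and its indices -/

/-- The consensus matrix `P = I - (κ / d_max) L`, with `L` the Laplacian of the graph. -/
def consensusMatrix {M : ℕ} (G : SimpleGraph (Fin M)) [DecidableRel G.Adj] (κ : ℝ) :
    Matrix (Fin M) (Fin M) ℝ :=
  1 - (κ / (G.maxDegree : ℝ)) • G.lapMatrix ℝ

/-- `lam` lists the eigenvalues of `P` in nonincreasing order and `u` is a corresponding orthonormal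
basis of eigenvectors whose first member is `1_M / √M`. -/
structure IsModalDecomposition {M : ℕ} [NeZero M] (P : Matrix (Fin M) (Fin M) ℝ)
    (lam : Fin M → ℝ) (u : Fin M → Fin M → ℝ) : Prop where
  orthonormal : ∀ p j, u p ⬝ᵥ u j = if p = j then 1 else 0
  eigen : ∀ p, P.mulVec (u p) = lam p • u p
  antitone : Antitone lam
  first : ∀ d, u 0 d = 1 / Real.sqrt M

/-- The sum of the nonnegative products `u_p^d u_j^d`. -/
def nuPlus {M : ℕ} (u : Fin M → Fin M → ℝ) (p j : Fin M) : ℝ :=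
  ∑ d, if 0 ≤ u p d * u j d then u p d * u j d else 0

/-- The sum of the nonpositive products `u_p^d u_j^d`. -/
def nuMinus {M : ℕ} (u : Fin M → Fin M → ℝ) (p j : Fin M) : ℝ :=
  ∑ d, if u p d * u j d ≤ 0 then u p d * u j d else 0

/-- The coefficients `a_{pj}(k)`. -/
def aCoeff {M : ℕ} (lam : Fin M → ℝ) (u : Fin M → Fin M → ℝ) (p j k : Fin M) : ℝ :=
  if 0 ≤ lam p * lam j then
    if 0 ≤ u p k * u j k then nuPlus u p j * (u p k * u j k)
    else nuMinus u p j * (u p k * u j k)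
  else max |nuMinus u p j| (nuPlus u p j) * |u p k * u j k|

/-- The graph explore-exploit index `ε_n`; the sum omits the first eigenvalue. -/
def epsN {M : ℕ} [NeZero M] (lam : Fin M → ℝ) : ℝ :=
  Real.sqrt M * ∑ p ∈ Finset.univ.filter (fun p : Fin M => p ≠ 0), |lam p| / (1 - |lam p|)

/-- The nodal explore-exploit centrality index `ε_c^k`; the inner sum omits the first eigenvalue. -/
def epsC {M : ℕ} [NeZero M] (lam : Fin M → ℝ) (u : Fin M → Fin M → ℝ) (k : Fin M) : ℝ :=
  M * ∑ p : Fin M, ∑ j ∈ Finset.univ.filter (fun j : Fin M => j ≠ 0),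
    |lam p * lam j| / (1 - |lam p * lam j|) * aCoeff lam u p j k

/-! ### Cooperative estimation (along one sample path) -/

/-- `nHat P arm i t k` is agent `k`'s estimate at time `t` of the number of selections of arm `i` per
unit agent: `n̂_i(t) = P (n̂_i(t-1) + ξ_i(t))`. -/
def nHat {M N : ℕ} (P : Matrix (Fin M) (Fin M) ℝ) (arm : ℕ → Fin M → Fin N) (i : Fin N) :
    ℕ → Fin M → ℝ
  | 0 => 0
  | t + 1 => P.mulVec (nHat P arm i t + fun k => if arm (t + 1) k = i then 1 else 0)

/-- `sHat P arm r i t k` is agent `k`'s estimate at time `t` of the total reward provided at arm `i`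
per unit agent. The realized reward enters whether or not a collision took place: under the
constrained reward model colliding agents receive no reward but still observe its value. -/
def sHat {M N : ℕ} (P : Matrix (Fin M) (Fin M) ℝ) (arm : ℕ → Fin M → Fin N)
    (r : ℕ → Fin M → Fin N → ℝ) (i : Fin N) : ℕ → Fin M → ℝ
  | 0 => 0
  | t + 1 => P.mulVec
      (sHat P arm r i t + fun k => if arm (t + 1) k = i then r (t + 1) k i else 0)

/-- The estimated mean `μ̂_i^k(t)`. -/
def muHat {M N : ℕ} (P : Matrix (Fin M) (Fin M) ℝ) (arm : ℕ → Fin M → Fin N)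
    (r : ℕ → Fin M → Fin N → ℝ) (i : Fin N) (t : ℕ) (k : Fin M) : ℝ :=
  sHat P arm r i t k / nHat P arm i t k

/-! ### The algorithm coop-UCB2-selective-learning -/

/-- The parameters: the sub-Gaussian parameter `σ_g`, the numbers `γ`, `η` and the function `f`. -/
structure Params where
  /-- sub-Gaussian parameter -/
  σg : ℝ
  /-- exploration parameter -/
  γ : ℝ
  /-- peeling parameter -/
  η : ℝ
  /-- sublogarithmic function -/
  f : ℝ → ℝ

/-- Admissible parameters: `σ_g > 0`, `γ > 1`, `η ∈ (0, 4)`, and `f : [1, ∞) → [0, ∞)` is increasing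
and sublogarithmic. -/
structure Params.Admissible (θ : Params) : Prop where
  σg_pos : 0 < θ.σg
  one_lt_γ : 1 < θ.γ
  η_pos : 0 < θ.η
  η_lt : θ.η < 4
  f_nonneg : ∀ x, 1 ≤ x → 0 ≤ θ.f x
  f_strictMono : StrictMonoOn θ.f (Set.Ici 1)
  f_isLittleO : θ.f =o[Filter.atTop] Real.log

/-- `G(η) = 1 - η² / 16`. -/
def Params.G (θ : Params) : ℝ := 1 - θ.η ^ 2 / 16

/-- The confidence width `C_i^k(t)`. -/
def width {M N : ℕ} (P : Matrix (Fin M) (Fin M) ℝ) (θ : Params) (arm : ℕ → Fin M → Fin N)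
    (i : Fin N) (t : ℕ) (k : Fin M) : ℝ :=
  θ.σg * Real.sqrt (2 * θ.γ / θ.G *
    ((nHat P arm i t k + θ.f t) / (M * nHat P arm i t k)) * (Real.log t / nHat P arm i t k))

/-- The upper index `Q_i^k(t) = μ̂_i^k(t) + C_i^k(t)`. It is `+∞` as long as no information about arm
`i` has reached agent `k`, that is, as long as `n̂_i^k(t) = 0` (which after the initialization is only
possible if `P` has a zero diagonal entry). -/
def upperIndex {M N : ℕ} (P : Matrix (Fin M) (Fin M) ℝ) (θ : Params) (arm : ℕ → Fin M → Fin N)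
    (r : ℕ → Fin M → Fin N → ℝ) (i : Fin N) (t : ℕ) (k : Fin M) : EReal :=
  if nHat P arm i t k = 0 then ⊤
  else ((muHat P arm r i t k + width P θ arm i t k : ℝ) : EReal)

/-- The lower index `W_i^k(t) = μ̂_i^k(t) - C_i^k(t)`; it is `-∞` as long as `n̂_i^k(t) = 0`. -/
def lowerIndex {M N : ℕ} (P : Matrix (Fin M) (Fin M) ℝ) (θ : Params) (arm : ℕ → Fin M → Fin N)
    (r : ℕ → Fin M → Fin N → ℝ) (i : Fin N) (t : ℕ) (k : Fin M) : EReal :=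
  if nHat P arm i t k = 0 then ⊥
  else ((muHat P arm r i t k - width P θ arm i t k : ℝ) : EReal)

/-- The selections `arm`, made along the rewards `r`, follow coop-UCB2-selective-learning.
For `t ≤ N` agent `k` samples the arms round-robin, beginning with the `k`-th arm. At a later time
`t + 1`, it forms a set `O` of arms with the highest values of the upper index at time `t`, as many
as its own rank, and selects an arm of `O` with the minimum lower index. Ties are broken arbitrarily. -/
structure IsSelectiveLearning {M N : ℕ} (P : Matrix (Fin M) (Fin M) ℝ) (θ : Params)
    (arm : ℕ → Fin M → Fin N) (r : ℕ → Fin M → Fin N → ℝ) : Prop where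
  initialization : ∀ t, 1 ≤ t → t ≤ N → ∀ k : Fin M, (arm t k : ℕ) = (t - 1 + k) % N
  selection : ∀ t, N ≤ t → ∀ k : Fin M, ∃ O : Finset (Fin N),
    O.card = (k : ℕ) + 1 ∧
    (∀ i ∈ O, ∀ j ∉ O, upperIndex P θ arm r j t k ≤ upperIndex P θ arm r i t k) ∧
    arm (t + 1) k ∈ O ∧
    ∀ j ∈ O, lowerIndex P θ arm r (arm (t + 1) k) t k ≤ lowerIndex P θ arm r j t k

/-! ### The quantities in the bound -/

/-- The number `n_i^k(T)` of selections of arm `i` by agent `k` at the times `1, …, T`. -/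
def selections {M N : ℕ} (arm : ℕ → Fin M → Fin N) (i : Fin N) (k : Fin M) (T : ℕ) : ℕ :=
  ((Finset.Icc 1 T).filter (fun t => arm t k = i)).card

/-- The smallest distance between the means of two different arms. -/
def gapMin {N : ℕ} (m : Fin N → ℝ) : ℝ :=
  ⨅ q : {q : Fin N × Fin N // q.1 ≠ q.2}, |m q.1.1 - m q.1.2|

/-- The graph-dependent constant `L̄`. -/
def LBar (M N : ℕ) (θ : Params) (εn : ℝ) (tdag : Fin M → ℝ) : ℝ :=
  ∑ k, (tdag k - 1) + M * (1 + εn) + 1 +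
    2 * M * (N + 1) / Real.log (1 + θ.η) *
      (1 / (θ.γ - 1) ^ 2 + θ.γ * Real.log ((1 + εn) * (1 + θ.η)) / (θ.γ - 1) + 1)

end CoopBandit

end

noncomputable section

namespace CoopBandit

/-! ### The consensus matrix -/

section ConsensusMatrix

variable {M : ℕ} (G : SimpleGraph (Fin M)) [DecidableRel G.Adj] {κ : ℝ}

/-! Unrolled, `nHat` and `sHat` at time `t` are sums over past selections with the deterministic
weights `(P ^ (t - τ)) k d`. `P` is stochastic and symmetric, and connectivity makes 1 a simple
eigenvalue, so its modal expansion is the uniform average plus geometrically decaying modes. This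
gives two deterministic facts about any selection sequence: `M * nHat` counts the selections made by
all agents up to `M * epsN`, and `M` times the sum of squared weights is at most `nHat + epsC`
(`abs_sub_average_le`, `sum_sq_sub_le`).

Up to a constant, the sum of squared weights is the variance proxy of `sHat - m i * nHat`. As
selections are predictable, an exponential supermartingale and Markov's inequality control the
deviation for one fixed tilt (`measure_le_exp`). The proxy is random, so its range is peeled into
geometric layers, each with its own tilt (`peeling_le`). Once `f t ≥ epsC`, the confidence width
dominates the proxy, and a deviation beyond it has probability of order `log t * t ^ (-γ)`, which is
summable (`measure_deviation_le`, `sum_tail_le`).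

Without deviations, an incorrect selection forces `gapMin ≤ 2 * width`: a set of `k + 1` arms
containing one worse than the target misses an arm at least as good as the target, and every such
set contains an arm no better than the target (`gapMin_le_width`). Solving this quadratic inequality
bounds `M * nHat` by the leading term (`mul_nHat_le_leadingTerm`).

Pathwise, cut at the last incorrect selection with `M * nHat` below the leading term
(`sum_selections_le`). Up to the cut, that single agent's estimate bounds the selections of all
agents together, which is why the leading term is paid once and not once per agent. After the cut,
each incorrect selection is charged to a deviation or to a time before `tdag`. -/

lemma consensusMatrix_nonneg (hκ0 : 0 < κ) (hκ1 : κ ≤ 1) (k d : Fin M) :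
    0 ≤ consensusMatrix G κ k d := by
  have hc : 0 ≤ κ / (G.maxDegree : ℝ) := by positivity
  simp only [consensusMatrix, SimpleGraph.lapMatrix, SimpleGraph.degMatrix, Matrix.sub_apply,
    Matrix.smul_apply, SimpleGraph.adjMatrix_apply, smul_eq_mul]
  by_cases h : k = d
  · subst h
    have hd : (G.degree k : ℝ) ≤ G.maxDegree := by exact_mod_cast G.degree_le_maxDegree k
    have : κ / (G.maxDegree : ℝ) * G.degree k ≤ 1 := by
      rcases (Nat.cast_nonneg G.maxDegree : (0 : ℝ) ≤ G.maxDegree).eq_or_lt with h0 | h0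
      -- Without edges the quotient `κ / 0` is `0`, so `P` is the identity.
      · simp [← h0]
      · rw [div_mul_eq_mul_div, div_le_one h0]
        nlinarith [(Nat.cast_nonneg (G.degree k) : (0 : ℝ) ≤ _)]
    simpa using this
  · rw [Matrix.one_apply_ne h, Matrix.diagonal_apply_ne _ h]
    split_ifs <;> simp [hc]

lemma consensusMatrix_mulVec_one : (consensusMatrix G κ).mulVec 1 = 1 := by
  have h : (G.lapMatrix ℝ).mulVec 1 = 0 := G.lapMatrix_mulVec_const_eq_zero
  simp [consensusMatrix, Matrix.sub_mulVec, Matrix.smul_mulVec, h]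

variable {G}

lemma eq_of_consensusMatrix_mulVec_eq [Nontrivial (Fin M)] (hG : G.Connected) (hκ0 : 0 < κ)
    {x : Fin M → ℝ} (hx : (consensusMatrix G κ).mulVec x = x) (i j : Fin M) : x i = x j := by
  have hd : 0 < G.maxDegree :=
    (hG.preconnected.degree_pos_of_nontrivial i).trans_le (G.degree_le_maxDegree i)
  have hc : κ / (G.maxDegree : ℝ) ≠ 0 := by positivity
  have hL : (G.lapMatrix ℝ).mulVec x = 0 := by
    rw [consensusMatrix, Matrix.sub_mulVec, Matrix.one_mulVec, Matrix.smul_mulVec,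
      sub_eq_self] at hx
    exact (smul_eq_zero.mp hx).resolve_left hc
  exact G.lapMatrix_mulVec_eq_zero_iff_forall_reachable.mp hL i j (hG.preconnected i j)

variable [NeZero M] {lam : Fin M → ℝ} {u : Fin M → Fin M → ℝ}

lemma sqrt_card_pos : 0 < Real.sqrt M :=
  Real.sqrt_pos.mpr (by exact_mod_cast Nat.pos_of_neZero M)

lemma IsModalDecomposition.first_eq {P : Matrix (Fin M) (Fin M) ℝ}
    (h : IsModalDecomposition P lam u) : u 0 = (1 / Real.sqrt M) • (1 : Fin M → ℝ) := by
  ext d; simp [h.first]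

lemma IsModalDecomposition.lam_zero {P : Matrix (Fin M) (Fin M) ℝ}
    (h : IsModalDecomposition P lam u) (hP : P.mulVec 1 = 1) : lam 0 = 1 := by
  have h1 := h.eigen 0
  rw [h.first_eq, Matrix.mulVec_smul, hP] at h1
  have h2 := congrFun h1 0
  have h3 : 1 / Real.sqrt M ≠ 0 := (one_div_pos.mpr sqrt_card_pos).ne'
  simp only [Pi.smul_apply, Pi.one_apply, smul_eq_mul, mul_one] at h2
  exact (mul_eq_right₀ h3).mp h2.symm

/-- On a connected graph the fixed vectors of `P` are constant, hence multiples of `u 0`; a further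
eigenvector with eigenvalue 1 would be orthogonal to `u 0` and so vanish. -/
lemma IsModalDecomposition.abs_lam_lt_one (h : IsModalDecomposition (consensusMatrix G κ) lam u)
    (hG : G.Connected) (hκ0 : 0 < κ) (hlam : ∀ p, -1 < lam p) {p : Fin M} (hp : p ≠ 0) :
    |lam p| < 1 := by
  have : Nontrivial (Fin M) := ⟨p, 0, hp⟩
  refine abs_lt.mpr ⟨hlam p, lt_of_le_of_ne ?_ fun h1 => ?_⟩
  · rw [← h.lam_zero (consensusMatrix_mulVec_one G)]
    exact h.antitone (Fin.zero_le p)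
  · have he := h.eigen p
    rw [h1, one_smul] at he
    have hc : u p = u p 0 • (1 : Fin M → ℝ) := by
      ext d; simp [eq_of_consensusMatrix_mulVec_eq hG hκ0 he d 0]
    have h0 : u p ⬝ᵥ u 0 = 0 := by simpa [hp] using h.orthonormal p 0
    have h2 : u p ⬝ᵥ u p = 1 := by simpa using h.orthonormal p p
    rw [h.first_eq, dotProduct_smul, smul_eq_zero,
      or_iff_right (one_div_pos.mpr sqrt_card_pos).ne'] at h0
    rw [hc, dotProduct_smul, ← hc, h0, smul_zero] at h2
    exact zero_ne_one h2

end ConsensusMatrix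

/-! ### Powers of a stochastic matrix and its modal decomposition -/

section Modes

variable {M : ℕ} {P : Matrix (Fin M) (Fin M) ℝ}

lemma pow_nonneg_apply (hP : ∀ i j, 0 ≤ P i j) (s : ℕ) (i j : Fin M) : 0 ≤ (P ^ s) i j := by
  induction s generalizing i j with
  | zero => rw [pow_zero, Matrix.one_apply]; split_ifs <;> simp
  | succ s ih =>
    rw [pow_succ, Matrix.mul_apply]
    exact Finset.sum_nonneg fun l _ => mul_nonneg (ih i l) (hP l j)

lemma sum_pow_apply (hP1 : P.mulVec 1 = 1) (s : ℕ) (i : Fin M) : ∑ j, (P ^ s) i j = 1 := by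
  have h : (P ^ s).mulVec 1 = 1 := by
    induction s with
    | zero => simp
    | succ s ih => rw [pow_succ, ← Matrix.mulVec_mulVec, hP1, ih]
  simpa [Matrix.mulVec, dotProduct] using congrFun h i

variable [NeZero M] {lam : Fin M → ℝ} {u : Fin M → Fin M → ℝ} (h : IsModalDecomposition P lam u)

include h

/-- A square matrix with orthonormal rows has orthonormal columns. -/
lemma IsModalDecomposition.sum_mul_eq (k d : Fin M) :
    ∑ p, u p k * u p d = if k = d then 1 else 0 := by
  have h1 : (Matrix.of u) * (Matrix.of u).transpose = 1 := by
    ext p j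
    rw [Matrix.mul_apply, Matrix.one_apply, ← h.orthonormal p j]
    rfl
  have h2 : ((Matrix.of u).transpose * Matrix.of u) k d = (1 : Matrix (Fin M) (Fin M) ℝ) k d := by
    rw [mul_eq_one_comm.mp h1]
  rwa [Matrix.mul_apply, Matrix.one_apply] at h2

lemma IsModalDecomposition.pow_mulVec (s : ℕ) (p : Fin M) :
    (P ^ s).mulVec (u p) = lam p ^ s • u p := by
  induction s with
  | zero => simp
  | succ s ih =>
    rw [pow_succ, ← Matrix.mulVec_mulVec, h.eigen, Matrix.mulVec_smul, ih, smul_smul, pow_succ,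
      mul_comm]

lemma IsModalDecomposition.pow_apply (s : ℕ) (k d : Fin M) :
    (P ^ s) k d = ∑ p, lam p ^ s * (u p k * u p d) := by
  calc (P ^ s) k d = ∑ l, (P ^ s) k l * ∑ p, u p l * u p d := by
        simp [h.sum_mul_eq]
    _ = ∑ p, (∑ l, (P ^ s) k l * u p l) * u p d := by
        simp_rw [Finset.mul_sum, Finset.sum_mul]
        rw [Finset.sum_comm]
        exact Finset.sum_congr rfl fun p _ => Finset.sum_congr rfl fun l _ => by ring
    _ = _ := by
        refine Finset.sum_congr rfl fun p _ => ?_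
        have := congrFun (h.pow_mulVec s p) k
        simp only [Matrix.mulVec, dotProduct, Pi.smul_apply, smul_eq_mul] at this
        rw [this]; ring

lemma IsModalDecomposition.abs_apply_le_one (p d : Fin M) : |u p d| ≤ 1 := by
  have h1 : ∑ d, u p d * u p d = 1 := by simpa [dotProduct] using h.orthonormal p p
  have h2 : u p d * u p d ≤ 1 := by
    rw [← h1]
    exact Finset.single_le_sum (f := fun d => u p d * u p d)
      (fun d _ => mul_self_nonneg _) (Finset.mem_univ d)
  exact abs_le_one_iff_mul_self_le_one.mpr h2

lemma IsModalDecomposition.abs_sum_mul_le (p : Fin M) {x : Fin M → ℝ} (hx : ∀ d, x d ∈ Set.Icc 0 1) :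
    |∑ d, u p d * x d| ≤ Real.sqrt M := by
  have h1 : ∑ d, u p d ^ 2 = 1 := by
    simpa [dotProduct, sq] using h.orthonormal p p
  refine Real.abs_le_sqrt ((Finset.sum_mul_sq_le_sq_mul_sq _ _ _).trans ?_)
  rw [h1, one_mul]
  calc ∑ d, x d ^ 2 ≤ ∑ _d : Fin M, (1 : ℝ) :=
        Finset.sum_le_sum fun d _ => pow_le_one₀ (hx d).1 (hx d).2
    _ = M := by simp

omit [NeZero M] h in
lemma sum_range_pow_sub_le {x : ℝ} (hx0 : 0 ≤ x) (hx1 : x < 1) (t : ℕ) :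
    ∑ τ ∈ Finset.range t, x ^ (t - τ) ≤ x / (1 - x) := by
  have h1 : 0 < 1 - x := by linarith
  induction t with
  | zero => simp; positivity
  | succ t ih =>
    have : ∑ τ ∈ Finset.range t, x ^ (t + 1 - τ) = x * ∑ τ ∈ Finset.range t, x ^ (t - τ) := by
      rw [Finset.mul_sum]
      refine Finset.sum_congr rfl fun τ hτ => ?_
      rw [← pow_succ', Nat.sub_add_comm (Finset.mem_range.mp hτ).le]
    rw [Finset.sum_range_succ, this, Nat.add_sub_cancel_left, pow_one]
    calc x * ∑ τ ∈ Finset.range t, x ^ (t - τ) + x ≤ x * (x / (1 - x)) + x := by gcongr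
      _ = x / (1 - x) := by field_simp; ring

/-- The weighted counts of consensus estimation differ from the average by at most `ε_n`. -/
lemma IsModalDecomposition.abs_sub_average_le (hP1 : P.mulVec 1 = 1)
    (hlam : ∀ p, p ≠ 0 → |lam p| < 1) {x : ℕ → Fin M → ℝ} (hx : ∀ τ d, x τ d ∈ Set.Icc 0 1)
    (t : ℕ) (k : Fin M) :
    |∑ τ ∈ Finset.range t, ∑ d, (P ^ (t - τ)) k d * x τ d
      - (∑ τ ∈ Finset.range t, ∑ d, x τ d) / M| ≤ epsN lam := by
  have hM : Real.sqrt M * Real.sqrt M = M := Real.mul_self_sqrt (Nat.cast_nonneg M)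
  have hs := (sqrt_card_pos (M := M)).ne'
  -- Mode 0 has eigenvalue 1 and constant eigenvector, so it contributes exactly the average; only
  -- the decaying modes remain in the error.
  have hP : ∀ s d, (P ^ s) k d = 1 / M +
      ∑ p ∈ Finset.univ.filter (fun p : Fin M => p ≠ 0), lam p ^ s * (u p k * u p d) := by
    intro s d
    rw [h.pow_apply, ← Finset.add_sum_erase _ _ (Finset.mem_univ (0 : Fin M)), h.lam_zero hP1,
      h.first, h.first, one_pow, one_mul, div_mul_div_comm, hM, one_mul, Finset.filter_ne']
  have key : ∑ τ ∈ Finset.range t, ∑ d, (P ^ (t - τ)) k d * x τ d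
      - (∑ τ ∈ Finset.range t, ∑ d, x τ d) / M
      = ∑ p ∈ Finset.univ.filter (fun p : Fin M => p ≠ 0), ∑ τ ∈ Finset.range t,
          lam p ^ (t - τ) * (u p k * ∑ d, u p d * x τ d) := by
    rw [Finset.sum_comm (s := Finset.univ.filter _), Finset.sum_div, ← Finset.sum_sub_distrib]
    refine Finset.sum_congr rfl fun τ _ => ?_
    simp_rw [hP, add_mul, Finset.sum_add_distrib, Finset.sum_mul, Finset.mul_sum]
    rw [Finset.sum_comm, Finset.sum_div]
    simp_rw [one_div_mul_eq_div, add_sub_cancel_left]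
    exact Finset.sum_congr rfl fun p _ => Finset.sum_congr rfl fun d _ => by ring
  rw [key, epsN, Finset.mul_sum]
  refine (Finset.abs_sum_le_sum_abs _ _).trans (Finset.sum_le_sum fun p hp => ?_)
  have hp := hlam p (Finset.mem_filter.mp hp).2
  calc |∑ τ ∈ Finset.range t, lam p ^ (t - τ) * (u p k * ∑ d, u p d * x τ d)|
      ≤ ∑ τ ∈ Finset.range t, |lam p| ^ (t - τ) * (1 * Real.sqrt M) := by
        refine (Finset.abs_sum_le_sum_abs _ _).trans (Finset.sum_le_sum fun τ _ => ?_)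
        rw [abs_mul, abs_mul, abs_pow]
        gcongr
        · exact h.abs_apply_le_one p k
        · exact h.abs_sum_mul_le p (hx τ)
    _ = Real.sqrt M * ∑ τ ∈ Finset.range t, |lam p| ^ (t - τ) := by
        rw [← Finset.sum_mul]; ring
    _ ≤ _ := by
        gcongr
        exact sum_range_pow_sub_le (abs_nonneg _) hp t

omit [NeZero M] h in
lemma sum_mul_le_nuPlus (p j : Fin M) {x : Fin M → ℝ} (hx : ∀ d, x d ∈ Set.Icc 0 1) :
    ∑ d, u p d * u j d * x d ≤ nuPlus u p j := by
  refine Finset.sum_le_sum fun d _ => ?_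
  obtain ⟨h0, h1⟩ := hx d
  split_ifs with h <;> nlinarith

omit [NeZero M] h in
lemma nuMinus_le_sum_mul (p j : Fin M) {x : Fin M → ℝ} (hx : ∀ d, x d ∈ Set.Icc 0 1) :
    nuMinus u p j ≤ ∑ d, u p d * u j d * x d := by
  refine Finset.sum_le_sum fun d _ => ?_
  obtain ⟨h0, h1⟩ := hx d
  split_ifs with h <;> nlinarith

omit [NeZero M] h in
lemma nuPlus_nonneg (p j : Fin M) : 0 ≤ nuPlus u p j :=
  Finset.sum_nonneg fun d _ => by split_ifs with h <;> simp [h]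

omit [NeZero M] h in
lemma nuMinus_nonpos (p j : Fin M) : nuMinus u p j ≤ 0 :=
  Finset.sum_nonpos fun d _ => by split_ifs with h <;> simp [h]

omit [NeZero M] h in
-- The three cases in `aCoeff` are the worst cases over `x`: a fixed nonnegative sign of the power
-- pairs `u p k * u j k` with the extreme sum of the same sign, while a negative `lam p * lam j`
-- makes the sign alternate with `s` and forces absolute values.
lemma pow_mul_le_aCoeff (p j k : Fin M) (s : ℕ) {x : Fin M → ℝ} (hx : ∀ d, x d ∈ Set.Icc 0 1) :
    (lam p * lam j) ^ s * (u p k * u j k * ∑ d, u p d * u j d * x d)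
      ≤ |lam p * lam j| ^ s * aCoeff lam u p j k := by
  have h1 := sum_mul_le_nuPlus (u := u) p j hx
  have h2 := nuMinus_le_sum_mul (u := u) p j hx
  set y := ∑ d, u p d * u j d * x d
  unfold aCoeff
  split_ifs with hl hu
  · rw [abs_of_nonneg hl]
    gcongr ?_ * ?_
    rw [mul_comm]
    gcongr
  · rw [abs_of_nonneg hl]
    gcongr ?_ * ?_
    rw [mul_comm]
    exact mul_le_mul_of_nonpos_right h2 (not_le.mp hu).le
  · refine (le_abs_self _).trans ?_
    rw [abs_mul, abs_pow, abs_mul _ y, mul_comm _ |y|]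
    gcongr
    rw [abs_of_nonpos (nuMinus_nonpos p j)]
    exact abs_le.mpr ⟨by linarith [le_max_left (-nuMinus u p j) (nuPlus u p j)],
      h1.trans (le_max_right _ _)⟩

omit [NeZero M] h in
lemma aCoeff_nonneg (p j k : Fin M) : 0 ≤ aCoeff lam u p j k := by
  unfold aCoeff
  split_ifs with hl hu
  · exact mul_nonneg (nuPlus_nonneg p j) hu
  · exact mul_nonneg_of_nonpos_of_nonpos (nuMinus_nonpos p j) (not_le.mp hu).le
  · exact mul_nonneg ((abs_nonneg _).trans (le_max_left _ _)) (abs_nonneg _)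

/-- The sum of the squared weights exceeds the weighted count by at most `ε_c^k`, after scaling. -/
lemma IsModalDecomposition.sum_sq_sub_le (hP1 : P.mulVec 1 = 1)
    (hlam : ∀ p, p ≠ 0 → |lam p| < 1) {x : ℕ → Fin M → ℝ} (hx : ∀ τ d, x τ d ∈ Set.Icc 0 1)
    (t : ℕ) (k : Fin M) :
    ∑ τ ∈ Finset.range t, ∑ d, (M * (P ^ (t - τ)) k d ^ 2 - (P ^ (t - τ)) k d) * x τ d
      ≤ epsC lam u k := by
  have hM : Real.sqrt M * Real.sqrt M = M := Real.mul_self_sqrt (Nat.cast_nonneg M)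
  have hM0 : (M : ℝ) ≠ 0 := by exact_mod_cast NeZero.ne M
  -- Squaring the modal expansion gives a double sum whose `j = 0` terms add up to `(P ^ s) k d /
  -- M`; the subtraction removes precisely these.
  have hP : ∀ s d, M * (P ^ s) k d ^ 2 - (P ^ s) k d = M * ∑ p, ∑ j ∈ Finset.univ.filter
      (fun j : Fin M => j ≠ 0), (lam p * lam j) ^ s * (u p k * u j k * (u p d * u j d)) := by
    intro s d
    have h1 : (P ^ s) k d ^ 2
        = ∑ p, ∑ j, (lam p * lam j) ^ s * (u p k * u j k * (u p d * u j d)) := by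
      rw [sq, h.pow_apply, Finset.sum_mul_sum]
      exact Finset.sum_congr rfl fun p _ => Finset.sum_congr rfl fun j _ => by
        rw [mul_pow]; ring
    have h2 : ∑ p, (lam p * lam 0) ^ s * (u p k * u 0 k * (u p d * u 0 d)) = (P ^ s) k d / M := by
      rw [h.pow_apply, Finset.sum_div]
      refine Finset.sum_congr rfl fun p _ => ?_
      rw [h.lam_zero hP1, h.first, h.first, mul_one]
      have : lam p ^ s * (u p k * (1 / Real.sqrt M) * (u p d * (1 / Real.sqrt M)))
          = lam p ^ s * (u p k * u p d) / (Real.sqrt M * Real.sqrt M) := by ring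
      rw [this, hM]
    have h3 : ∀ p, ∑ j ∈ Finset.univ.filter (fun j : Fin M => j ≠ 0),
        (lam p * lam j) ^ s * (u p k * u j k * (u p d * u j d))
        = ∑ j, (lam p * lam j) ^ s * (u p k * u j k * (u p d * u j d))
          - (lam p * lam 0) ^ s * (u p k * u 0 k * (u p d * u 0 d)) := fun p => by
      rw [Finset.filter_ne', Finset.sum_erase_eq_sub (Finset.mem_univ _)]
    simp_rw [h3]
    rw [Finset.sum_sub_distrib, h2, ← h1, mul_sub, mul_div_cancel₀ _ hM0]
  have key : ∑ τ ∈ Finset.range t, ∑ d, (M * (P ^ (t - τ)) k d ^ 2 - (P ^ (t - τ)) k d) * x τ d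
      = M * ∑ p, ∑ j ∈ Finset.univ.filter (fun j : Fin M => j ≠ 0), ∑ τ ∈ Finset.range t,
          (lam p * lam j) ^ (t - τ) * (u p k * u j k * ∑ d, u p d * u j d * x τ d) := by
    rw [Finset.sum_comm_cycle, Finset.mul_sum]
    refine Finset.sum_congr rfl fun τ _ => ?_
    simp_rw [hP, Finset.mul_sum, Finset.sum_mul]
    rw [Finset.sum_comm_cycle (u := Finset.univ)]
    refine Finset.sum_congr rfl fun d _ => Finset.sum_congr rfl fun p _ =>
      Finset.sum_congr rfl fun j _ => by ring
  rw [key, epsC]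
  gcongr with p _ j hj
  have hj := hlam j (Finset.mem_filter.mp hj).2
  have hpj : |lam p * lam j| < 1 := by
    rw [abs_mul]
    rcases eq_or_ne p 0 with rfl | hp
    · rwa [h.lam_zero hP1, abs_one, one_mul]
    · exact mul_lt_one_of_nonneg_of_lt_one_left (abs_nonneg _) (hlam p hp) hj.le
  calc _ ≤ ∑ τ ∈ Finset.range t, |lam p * lam j| ^ (t - τ) * aCoeff lam u p j k :=
        Finset.sum_le_sum fun τ _ => pow_mul_le_aCoeff p j k _ (hx τ)
    _ = (∑ τ ∈ Finset.range t, |lam p * lam j| ^ (t - τ)) * aCoeff lam u p j k := by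
        rw [Finset.sum_mul]
    _ ≤ _ := by
        gcongr
        · exact aCoeff_nonneg p j k
        · exact sum_range_pow_sub_le (abs_nonneg _) hpj t

end Modes

/-! ### Consensus estimation along one sample path -/

section Estimation

variable {M N : ℕ} {P : Matrix (Fin M) (Fin M) ℝ}

/-- The indicator that agent `d` selects arm `i` at time `τ + 1`. -/
def selInd (arm : ℕ → Fin M → Fin N) (i : Fin N) (τ : ℕ) (d : Fin M) : ℝ :=
  if arm (τ + 1) d = i then 1 else 0

/-- The sum of the squared weights with which the selections of arm `i` enter the estimates of
agent `k` at time `t`. -/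
def sqWeight (P : Matrix (Fin M) (Fin M) ℝ) (arm : ℕ → Fin M → Fin N) (i : Fin N) (t : ℕ)
    (k : Fin M) : ℝ :=
  ∑ τ ∈ Finset.range t, ∑ d, (P ^ (t - τ)) k d ^ 2 * selInd arm i τ d

lemma selInd_mem_Icc (arm : ℕ → Fin M → Fin N) (i : Fin N) (τ : ℕ) (d : Fin M) :
    selInd arm i τ d ∈ Set.Icc 0 1 := by
  unfold selInd; split_ifs <;> simp

lemma eq_sum_pow_mulVec_of_succ {x y : ℕ → Fin M → ℝ} (h0 : x 0 = 0)
    (hs : ∀ t, x (t + 1) = P.mulVec (x t + y t)) (t : ℕ) :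
    x t = ∑ τ ∈ Finset.range t, (P ^ (t - τ)).mulVec (y τ) := by
  induction t with
  | zero => simp [h0]
  | succ t ih =>
    rw [hs, Matrix.mulVec_add, ih, Matrix.mulVec_sum, Finset.sum_range_succ,
      Nat.add_sub_cancel_left, pow_one]
    congr 1
    refine Finset.sum_congr rfl fun τ hτ => ?_
    rw [Matrix.mulVec_mulVec, ← pow_succ', Nat.sub_add_comm (Finset.mem_range.mp hτ).le]

lemma nHat_eq_sum (arm : ℕ → Fin M → Fin N) (i : Fin N) (t : ℕ) (k : Fin M) :
    nHat P arm i t k = ∑ τ ∈ Finset.range t, ∑ d, (P ^ (t - τ)) k d * selInd arm i τ d := by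
  rw [eq_sum_pow_mulVec_of_succ (P := P) (x := nHat P arm i) (y := selInd arm i) rfl
    (fun _ => rfl) t, Finset.sum_apply]
  rfl

lemma sHat_eq_sum (arm : ℕ → Fin M → Fin N) (r : ℕ → Fin M → Fin N → ℝ) (i : Fin N) (t : ℕ)
    (k : Fin M) :
    sHat P arm r i t k = ∑ τ ∈ Finset.range t, ∑ d,
      (P ^ (t - τ)) k d * (selInd arm i τ d * r (τ + 1) d i) := by
  rw [eq_sum_pow_mulVec_of_succ (P := P) (x := sHat P arm r i)
    (y := fun τ d => if arm (τ + 1) d = i then r (τ + 1) d i else 0) rfl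
    (fun _ => rfl) t, Finset.sum_apply]
  simp [Matrix.mulVec, dotProduct, selInd]

lemma nHat_nonneg (hP : ∀ i j, 0 ≤ P i j) (arm : ℕ → Fin M → Fin N) (i : Fin N) (t : ℕ)
    (k : Fin M) : 0 ≤ nHat P arm i t k := by
  rw [nHat_eq_sum]
  exact Finset.sum_nonneg fun τ _ => Finset.sum_nonneg fun d _ =>
    mul_nonneg (pow_nonneg_apply hP _ _ _) (selInd_mem_Icc arm i τ d).1

lemma sum_selInd_eq (arm : ℕ → Fin M → Fin N) (i : Fin N) (t : ℕ) :
    ∑ τ ∈ Finset.range t, ∑ d, selInd arm i τ d = ∑ d, (selections arm i d t : ℝ) := by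
  rw [Finset.sum_comm]
  refine Finset.sum_congr rfl fun d _ => ?_
  rw [selections, Finset.card_filter, Nat.cast_sum, Finset.range_eq_Ico]
  have h := Finset.sum_Ico_add' (fun τ => if arm τ d = i then (1 : ℝ) else 0) 0 t 1
  simp only [selInd, h]
  refine Finset.sum_congr ?_ fun τ _ => by simp
  ext; simp

variable [NeZero M] {lam : Fin M → ℝ} {u : Fin M → Fin M → ℝ}

lemma IsModalDecomposition.sum_selections_le (h : IsModalDecomposition P lam u)
    (hP1 : P.mulVec 1 = 1) (hlam : ∀ p, p ≠ 0 → |lam p| < 1) (arm : ℕ → Fin M → Fin N) (i : Fin N)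
    (t : ℕ) (k : Fin M) :
    ∑ d, (selections arm i d t : ℝ) ≤ M * (nHat P arm i t k + epsN lam) := by
  have hM0 : (0 : ℝ) < M := by exact_mod_cast Nat.pos_of_neZero M
  have h1 := (abs_le.mp (h.abs_sub_average_le hP1 hlam (selInd_mem_Icc arm i) t k)).1
  rw [← nHat_eq_sum, sum_selInd_eq] at h1
  rw [← div_le_iff₀' hM0]
  linarith

lemma epsN_nonneg (hlam : ∀ p, p ≠ 0 → |lam p| < 1) : 0 ≤ epsN lam :=
  mul_nonneg (Real.sqrt_nonneg _) (Finset.sum_nonneg fun p hp => div_nonneg (abs_nonneg _)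
    (sub_nonneg.mpr (hlam p (Finset.mem_filter.mp hp).2).le))

lemma IsModalDecomposition.mul_sqWeight_le (h : IsModalDecomposition P lam u)
    (hP1 : P.mulVec 1 = 1) (hlam : ∀ p, p ≠ 0 → |lam p| < 1) (arm : ℕ → Fin M → Fin N) (i : Fin N)
    (t : ℕ) (k : Fin M) :
    M * sqWeight P arm i t k ≤ nHat P arm i t k + epsC lam u k := by
  have h1 := h.sum_sq_sub_le hP1 hlam (selInd_mem_Icc arm i) t k
  have h2 : ∑ τ ∈ Finset.range t, ∑ d, (M * (P ^ (t - τ)) k d ^ 2 - (P ^ (t - τ)) k d)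
      * selInd arm i τ d = M * sqWeight P arm i t k - nHat P arm i t k := by
    simp_rw [sqWeight, nHat_eq_sum, Finset.mul_sum, ← Finset.sum_sub_distrib]
    exact Finset.sum_congr rfl fun _ _ => Finset.sum_congr rfl fun _ _ => by ring
  linarith

/-- Each row of `P ^ s` sums to 1, so its sum of squares is at most its largest entry. The largest
entries are the weights of a fictitious run in which exactly one agent selects at each time, to
which the `epsN` estimate applies. This bound limits the number of peeling layers. -/
lemma IsModalDecomposition.mul_sqWeight_le_time (h : IsModalDecomposition P lam u)
    (hP : ∀ i j, 0 ≤ P i j)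
    (hP1 : P.mulVec 1 = 1) (hlam : ∀ p, p ≠ 0 → |lam p| < 1) (arm : ℕ → Fin M → Fin N) (i : Fin N)
    {t : ℕ} (ht : M ≤ t) (k : Fin M) :
    M * sqWeight P arm i t k ≤ t * (1 + epsN lam) := by
  have hM0 : (0 : ℝ) < M := by exact_mod_cast Nat.pos_of_neZero M
  choose a ha using fun s => Finite.exists_max fun d => (P ^ s) k d
  have h1 : sqWeight P arm i t k ≤ ∑ τ ∈ Finset.range t, ∑ d,
      (P ^ (t - τ)) k d * if d = a (t - τ) then 1 else 0 := by
    refine Finset.sum_le_sum fun τ _ => ?_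
    simp only [mul_ite, mul_one, mul_zero, Finset.sum_ite_eq', Finset.mem_univ, if_true]
    calc ∑ d, (P ^ (t - τ)) k d ^ 2 * selInd arm i τ d
        ≤ ∑ d, (P ^ (t - τ)) k d * (P ^ (t - τ)) k (a (t - τ)) := by
          refine Finset.sum_le_sum fun d _ => ?_
          have h0 := pow_nonneg_apply hP (t - τ) k d
          calc _ ≤ (P ^ (t - τ)) k d ^ 2 * 1 := by
                gcongr; exact (selInd_mem_Icc arm i τ d).2
            _ ≤ _ := by rw [mul_one, sq]; gcongr; exact ha _ d
      _ = _ := by rw [← Finset.sum_mul, sum_pow_apply hP1, one_mul]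
  have h2 := (abs_le.mp (h.abs_sub_average_le hP1 hlam
    (x := fun τ d => if d = a (t - τ) then 1 else 0)
    (fun τ d => by split_ifs <;> simp) t k)).2
  have h3 : ∑ τ ∈ Finset.range t, ∑ d, (if d = a (t - τ) then (1 : ℝ) else 0) = t := by simp
  rw [h3, sub_le_iff_le_add] at h2
  have hMt : (M : ℝ) ≤ t := by exact_mod_cast ht
  calc M * sqWeight P arm i t k ≤ M * (epsN lam + t / M) := by
        gcongr; exact h1.trans h2
    _ = M * epsN lam + t := by field_simp
    _ ≤ _ := by nlinarith [epsN_nonneg hlam]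

/-- Small weights on actual selections are compensated by `epsC`: if agent `k` weighs `d` lightly,
it weighs other agents heavily, and `epsC` bounds the accumulated positive parts of `M q² - q`. Each
of the `M` distinct times `e d` then contributes at least `1 / M`. The lower bound 1 starts the
peeling even where `nHat` vanishes. -/
lemma IsModalDecomposition.one_le_nHat_add (h : IsModalDecomposition P lam u)
    (hP : ∀ i j, 0 ≤ P i j) (hP1 : P.mulVec 1 = 1) (hlam : ∀ p, p ≠ 0 → |lam p| < 1)
    (arm : ℕ → Fin M → Fin N) (i : Fin N) {t : ℕ} {e : Fin M → ℕ} (he : Function.Injective e)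
    (het : ∀ d, e d < t) (hei : ∀ d, arm (e d + 1) d = i) (k : Fin M) :
    1 ≤ nHat P arm i t k + epsC lam u k := by
  have hM0 : (0 : ℝ) < M := by exact_mod_cast Nat.pos_of_neZero M
  -- This choice keeps exactly the nonnegative values of `M q² - q` for `q ≥ 1 / M` and discards the
  -- other weights, making the lower bound on `epsC` as strong as possible.
  set x : ℕ → Fin M → ℝ := fun τ d => if 1 / (M : ℝ) ≤ (P ^ (t - τ)) k d then 1 else 0 with hx
  have h1 := h.sum_sq_sub_le hP1 hlam (x := x)
    (fun τ d => by simp only [hx]; split_ifs <;> simp) t k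
  set g : ℕ → ℝ := fun τ => ∑ d, ((P ^ (t - τ)) k d * selInd arm i τ d +
    (M * (P ^ (t - τ)) k d ^ 2 - (P ^ (t - τ)) k d) * x τ d) with hg
  have hxq : ∀ τ d, 0 ≤ (M * (P ^ (t - τ)) k d ^ 2 - (P ^ (t - τ)) k d) * x τ d := by
    intro τ d
    simp only [hx]
    split_ifs with hq
    · have := (div_le_iff₀ hM0).mp hq
      nlinarith [pow_nonneg_apply hP (t - τ) k d]
    · simp
  have hxd : ∀ τ d, (P ^ (t - τ)) k d - 1 / M ≤
      (M * (P ^ (t - τ)) k d ^ 2 - (P ^ (t - τ)) k d) * x τ d := by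
    intro τ d
    simp only [hx]
    split_ifs with hq
    · have : (M * (P ^ (t - τ)) k d ^ 2 - (P ^ (t - τ)) k d) * 1 - ((P ^ (t - τ)) k d - 1 / M)
          = M * ((P ^ (t - τ)) k d - 1 / M) ^ 2 := by field_simp
      nlinarith [mul_nonneg hM0.le (sq_nonneg ((P ^ (t - τ)) k d - 1 / M))]
    · linarith
  have hsel : ∀ τ d, 0 ≤ (P ^ (t - τ)) k d * selInd arm i τ d := fun τ d =>
    mul_nonneg (pow_nonneg_apply hP _ _ _) (selInd_mem_Icc arm i τ d).1
  have hg0 : ∀ τ, 0 ≤ g τ := fun τ => Finset.sum_nonneg fun d _ => add_nonneg (hsel τ d) (hxq τ d)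
  have hg1 : ∀ d, 1 / (M : ℝ) ≤ g (e d) := by
    intro d
    -- The row sums to 1 and `M - 1` copies of `1 / M` are subtracted. The terms `q - 1 / M` for the
    -- other agents are dominated through `hxd`, because `M q² - q` exceeds its tangent at `1 / M`
    -- by `M (q - 1 / M)²`.
    have hs : (P ^ (t - e d)) k d + ∑ j ∈ Finset.univ.erase d, ((P ^ (t - e d)) k j - 1 / M)
        = 1 / M := by
      rw [Finset.sum_sub_distrib, ← add_sub_assoc, Finset.add_sum_erase _ _ (Finset.mem_univ d),
        sum_pow_apply hP1]
      simp only [Finset.sum_const, Finset.card_erase_of_mem (Finset.mem_univ d), Finset.card_univ,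
        Fintype.card_fin, nsmul_eq_mul, Nat.cast_pred (Nat.pos_of_neZero M)]
      field_simp
      ring
    rw [← hs, hg]
    dsimp only
    rw [← Finset.add_sum_erase _ _ (Finset.mem_univ d)]
    refine add_le_add ?_ (Finset.sum_le_sum fun j _ => ?_)
    · simp only [selInd, hei, if_true, mul_one, le_add_iff_nonneg_right]
      exact hxq _ _
    · exact (hxd _ j).trans (le_add_of_nonneg_left (hsel _ j))
  calc (1 : ℝ) = ∑ _d : Fin M, 1 / (M : ℝ) := by
        simp [hM0.ne']
    _ ≤ ∑ d, g (e d) := Finset.sum_le_sum fun d _ => hg1 d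
    _ = ∑ τ ∈ Finset.univ.map ⟨e, he⟩, g τ := by simp
    _ ≤ ∑ τ ∈ Finset.range t, g τ :=
        Finset.sum_le_sum_of_subset_of_nonneg (fun τ hτ => by
          obtain ⟨d, -, rfl⟩ := Finset.mem_map.mp hτ
          exact Finset.mem_range.mpr (het d)) fun τ _ _ => hg0 τ
    _ ≤ _ := by
        simp_rw [hg, Finset.sum_add_distrib, ← nHat_eq_sum]
        linarith

omit [NeZero M] in
/-- During the initialization the agents sample arm `i` at pairwise different times. -/
lemma IsSelectiveLearning.exists_injective {θ : Params} {arm : ℕ → Fin M → Fin N}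
    {r : ℕ → Fin M → Fin N → ℝ} (h : IsSelectiveLearning P θ arm r) (hMN : M ≤ N) (i : Fin N) :
    ∃ e : Fin M → ℕ, Function.Injective e ∧ (∀ d, e d < N) ∧ ∀ d, arm (e d + 1) d = i := by
  -- Agent `d` meets arm `i` at zero-based time `i - d` modulo `N`; writing `N - d` keeps the
  -- subtraction in `ℕ`. These times differ because agents have different indices below `N`.
  have hN : 0 < N := i.pos
  have hmod : ∀ d : Fin M, ((i + (N - d)) % N + d) % N = i := by
    intro d
    have hd : (d : ℕ) < N := d.isLt.trans_le hMN
    rw [Nat.mod_add_mod, show (i : ℕ) + (N - d) + d = i + N by omega, Nat.add_mod_right,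
      Nat.mod_eq_of_lt i.isLt]
  refine ⟨fun d => (i + (N - d)) % N, fun d d' hdd => ?_, fun d => Nat.mod_lt _ hN, fun d => ?_⟩
  · have h1 := hmod d
    have h2 := hmod d'
    simp only at hdd
    rw [hdd] at h1
    have h3 : (d : ℕ) ≡ d' [MOD N] := Nat.ModEq.add_left_cancel' _ (h1.trans h2.symm)
    rw [Nat.ModEq, Nat.mod_eq_of_lt (d.isLt.trans_le hMN),
      Nat.mod_eq_of_lt (d'.isLt.trans_le hMN)] at h3
    exact Fin.ext h3
  · refine Fin.ext ?_
    rw [h.initialization _ (Nat.le_add_left _ _) (Nat.mod_lt _ hN), Nat.add_sub_cancel, hmod]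

end Estimation

/-! ### Exponential supermartingales -/

section Supermartingale

open scoped ENNReal

lemma IsSubGaussian.lintegral_le_one {p : Measure ℝ} [IsProbabilityMeasure p] {m σ : ℝ}
    (h : IsSubGaussian p m σ) (w : ℝ) :
    ∫⁻ x, ENNReal.ofReal (Real.exp (w * (x - m) - σ ^ 2 * w ^ 2 / 2)) ∂p ≤ 1 := by
  obtain ⟨hint, hcgf⟩ := h.2 w
  have hpos : 0 < mgf id p w := mgf_pos hint
  have hle : mgf id p w ≤ Real.exp (m * w + σ ^ 2 * w ^ 2 / 2) := by
    rw [← Real.exp_log hpos]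
    exact Real.exp_le_exp.mpr hcgf
  have hexp : ∀ x, Real.exp (w * (x - m) - σ ^ 2 * w ^ 2 / 2)
      = Real.exp (w * x) * Real.exp (-(m * w + σ ^ 2 * w ^ 2 / 2)) := by
    intro x; rw [← Real.exp_add]; ring_nf
  simp_rw [hexp]
  rw [← ofReal_integral_eq_lintegral_ofReal (hint.mul_const _)
    (Filter.Eventually.of_forall fun x => by positivity), integral_mul_const,
    ENNReal.ofReal_le_one]
  calc _ ≤ Real.exp (m * w + σ ^ 2 * w ^ 2 / 2) * Real.exp (-(m * w + σ ^ 2 * w ^ 2 / 2)) := by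
        gcongr; exact hle
    _ = 1 := by rw [← Real.exp_add, add_neg_cancel, Real.exp_zero]

variable {M N : ℕ} {p : Fin N → Measure ℝ} [∀ i, IsProbabilityMeasure (p i)] {m : Fin N → ℝ} {σ : ℝ}
  {Ω : Type*} {mΩ : MeasurableSpace Ω} {μ : Measure Ω} [IsProbabilityMeasure μ]
  {ℱ : Filtration ℕ mΩ} {r : ℕ → Fin M → Fin N → Ω → ℝ} {arm : ℕ → Fin M → Ω → Fin N}

lemma measurable_selInd (hprev : ∀ t k, Measurable[ℱ t] (arm (t + 1) k)) (i : Fin N) (τ : ℕ)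
    (d : Fin M) : Measurable[ℱ τ] fun ω => selInd (fun t k => arm t k ω) i τ d :=
  (measurable_of_finite fun a : Fin N => if a = i then (1 : ℝ) else 0).comp (hprev τ d)

omit mΩ [∀ i, IsProbabilityMeasure (p i)] in
lemma measurable_comap_prod_exp (X : Fin M → Fin N → Ω → ℝ) (m : Fin N → ℝ) (σ : ℝ) (i : Fin N)
    (w : Fin M → ℝ) (s : Finset (Fin M)) :
    Measurable[MeasurableSpace.comap (fun ω k i => X k i ω) inferInstance] fun ω =>
      ∏ d ∈ s, ENNReal.ofReal (Real.exp (w d * (X d i ω - m i) - σ ^ 2 * w d ^ 2 / 2)) := by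
  have hg : Measurable fun x : Fin M → Fin N → ℝ => ∏ d ∈ s, ENNReal.ofReal
    (Real.exp (w d * (x d i - m i) - σ ^ 2 * w d ^ 2 / 2)) := by fun_prop
  have h := hg.comp (comap_measurable fun ω k i => X k i ω)
  exact h

lemma comap_le_of_measurable {X : Fin M → Fin N → Ω → ℝ} (hX : ∀ k i, Measurable (X k i)) :
    MeasurableSpace.comap (fun ω k i => X k i ω) inferInstance ≤ mΩ :=
  Measurable.comap_le (measurable_pi_iff.mpr fun k => measurable_pi_iff.mpr fun i => hX k i)

omit [IsProbabilityMeasure μ] in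
lemma lintegral_prod_exp_le_one (hsub : ∀ i, IsSubGaussian (p i) (m i) σ)
    (hlaw : ∀ t k i, HasLaw (r (t + 1) k i) (p i) μ)
    (hmeas : ∀ t k i, Measurable (r (t + 1) k i))
    (hagents : ∀ t i, iIndepFun (fun k => r (t + 1) k i) μ) (i : Fin N) (w : Fin M → ℝ) (t : ℕ)
    (s : Finset (Fin M)) :
    ∫⁻ ω, ∏ d ∈ s, ENNReal.ofReal
      (Real.exp (w d * (r (t + 1) d i ω - m i) - σ ^ 2 * w d ^ 2 / 2)) ∂μ ≤ 1 := by
  have hφ : ∀ d, Measurable fun x : ℝ =>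
      ENNReal.ofReal (Real.exp (w d * (x - m i) - σ ^ 2 * w d ^ 2 / 2)) := fun d => by fun_prop
  refine (lintegral_prod_eq_prod_lintegral_of_indepFun s _ ((hagents t i).comp _ hφ)
    fun d => (hφ d).comp (hmeas t d i)).trans_le (Finset.prod_le_one' fun d _ => ?_)
  have h := (hlaw t d i).lintegral_comp (hφ d).aemeasurable
  simp only [Function.comp_apply]
  rw [h]
  exact (hsub i).lintegral_le_one (w d)

/-- The exponential process of the weighted rewards collected at arm `i` has mean at most one. -/
lemma lintegral_exp_sum_le_one (hsub : ∀ i, IsSubGaussian (p i) (m i) σ)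
    (hlaw : ∀ t k i, HasLaw (r (t + 1) k i) (p i) μ)
    (hadapted : ∀ t k i, Measurable[ℱ (t + 1)] (r (t + 1) k i))
    (hpast : ∀ t, Indep
      (MeasurableSpace.comap (fun ω k i => r (t + 1) k i ω) inferInstance) (ℱ t) μ)
    (hagents : ∀ t i, iIndepFun (fun k => r (t + 1) k i) μ)
    (hprev : ∀ t k, Measurable[ℱ t] (arm (t + 1) k)) (i : Fin N) (w : ℕ → Fin M → ℝ) (n : ℕ) :
    ∫⁻ ω, ENNReal.ofReal (Real.exp (∑ τ ∈ Finset.range n, ∑ d,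
      selInd (fun t k => arm t k ω) i τ d *
        (w τ d * (r (τ + 1) d i ω - m i) - σ ^ 2 * w τ d ^ 2 / 2))) ∂μ ≤ 1 := by
  have hmeas : ∀ t k i, Measurable (r (t + 1) k i) := fun t k i =>
    (hadapted t k i).mono (ℱ.le _) le_rfl
  induction n with
  | zero => simp
  | succ n ih =>
    set Z : Ω → ℝ≥0∞ := fun ω => ENNReal.ofReal (Real.exp (∑ τ ∈ Finset.range n, ∑ d,
      selInd (fun t k => arm t k ω) i τ d *
        (w τ d * (r (τ + 1) d i ω - m i) - σ ^ 2 * w τ d ^ 2 / 2))) with hZ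
    have hZm : Measurable[ℱ n] Z := by
      refine (ENNReal.measurable_ofReal.comp Real.measurable_exp).comp ?_
      refine Finset.measurable_fun_sum _ fun τ hτ => Finset.measurable_fun_sum _ fun d _ => ?_
      have hτ := Finset.mem_range.mp hτ
      have h1 : Measurable[ℱ n] fun ω => selInd (fun t k => arm t k ω) i τ d :=
        (measurable_selInd hprev i τ d).mono (ℱ.mono hτ.le) le_rfl
      have h2 : Measurable[ℱ n] fun ω => r (τ + 1) d i ω :=
        (hadapted τ d i).mono (ℱ.mono hτ) le_rfl
      exact h1.mul (((h2.sub_const _).const_mul _).sub_const _)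
    -- The space is split by the set of agents that select arm `i` at time `n + 1`. This set is
    -- known from the past, so on each piece the new factor is a product over a fixed set and
    -- independent of `Z`; no conditional expectation is needed.
    set B : Finset (Fin M) → Set Ω := fun s =>
      {ω | (Finset.univ.filter fun d => arm (n + 1) d ω = i) = s}
    have hB : ∀ s, MeasurableSet[ℱ n] (B s) := by
      intro s
      have : B s = ⋂ d, {ω | arm (n + 1) d ω = i ↔ d ∈ s} := by
        ext ω; simp [B, Finset.ext_iff]
      rw [this]
      refine MeasurableSet.iInter fun d => ?_
      exact hprev n d (Set.toFinite {a | a = i ↔ d ∈ s}).measurableSet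
    set Y : Finset (Fin M) → Ω → ℝ≥0∞ := fun s ω => ∏ d ∈ s, ENNReal.ofReal
      (Real.exp (w n d * (r (n + 1) d i ω - m i) - σ ^ 2 * w n d ^ 2 / 2))
    have hYm : ∀ s, Measurable[MeasurableSpace.comap (fun ω k i => r (n + 1) k i ω) inferInstance]
        (Y s) := fun s => measurable_comap_prod_exp _ m σ i (w n) s
    have hcomap : MeasurableSpace.comap (fun ω k i => r (n + 1) k i ω) inferInstance ≤ mΩ :=
      comap_le_of_measurable (hmeas n)
    have hsplit : ∀ ω, ENNReal.ofReal (Real.exp (∑ τ ∈ Finset.range (n + 1), ∑ d,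
        selInd (fun t k => arm t k ω) i τ d *
        (w τ d * (r (τ + 1) d i ω - m i) - σ ^ 2 * w τ d ^ 2 / 2)))
        = ∑ s, (B s).indicator Z ω * Y s ω := by
      intro ω
      rw [Finset.sum_eq_single (Finset.univ.filter fun d => arm (n + 1) d ω = i)]
      · rw [Set.indicator_of_mem (show ω ∈ B _ from rfl), Finset.sum_range_succ, Real.exp_add,
          ENNReal.ofReal_mul (Real.exp_nonneg _)]
        congr 1
        simp only [Y]
        rw [← ENNReal.ofReal_prod_of_nonneg fun _ _ => Real.exp_nonneg _, ← Real.exp_sum,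
          Finset.sum_filter]
        congr 2
        exact Finset.sum_congr rfl fun d _ => by simp [selInd]
      · intro s _ hs
        rw [Set.indicator_of_notMem (show ω ∉ B s from fun h => hs h.symm), zero_mul]
      · simp
    simp_rw [hsplit]
    rw [lintegral_finsetSum _ fun s _ =>
      ((hZm.indicator (hB s)).mono (ℱ.le n) le_rfl).fun_mul ((hYm s).mono hcomap le_rfl)]
    have hone : ∀ ω, ∑ s, (B s).indicator Z ω = Z ω := by
      intro ω
      rw [Finset.sum_eq_single (Finset.univ.filter fun d => arm (n + 1) d ω = i)]
      · exact Set.indicator_of_mem (show ω ∈ B _ from rfl) _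
      · intro s _ hs
        exact Set.indicator_of_notMem (show ω ∉ B s from fun h => hs h.symm) _
      · simp
    calc _ ≤ ∑ s, ∫⁻ ω, (B s).indicator Z ω ∂μ := by
          refine Finset.sum_le_sum fun s _ => ?_
          rw [lintegral_mul_eq_lintegral_mul_lintegral_of_independent_measurableSpace (ℱ.le n)
            hcomap (hpast n).symm (hZm.indicator (hB s)) (hYm s)]
          exact mul_le_of_le_one_right' (lintegral_prod_exp_le_one hsub hlaw hmeas hagents i _ n s)
      _ = ∫⁻ ω, Z ω ∂μ := by
          rw [← lintegral_finsetSum _ fun s _ => ((hZm.indicator (hB s)).mono (ℱ.le n) le_rfl)]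
          simp_rw [hone]
      _ ≤ 1 := ih

lemma sHat_sub_eq_sum (P : Matrix (Fin M) (Fin M) ℝ) (arm : ℕ → Fin M → Fin N)
    (r : ℕ → Fin M → Fin N → ℝ) (i : Fin N) (t : ℕ) (k : Fin M) (c : ℝ) :
    sHat P arm r i t k - c * nHat P arm i t k = ∑ τ ∈ Finset.range t, ∑ d,
      selInd arm i τ d * ((P ^ (t - τ)) k d * (r (τ + 1) d i - c)) := by
  simp_rw [sHat_eq_sum, nHat_eq_sum, Finset.mul_sum, ← Finset.sum_sub_distrib]
  exact Finset.sum_congr rfl fun _ _ => Finset.sum_congr rfl fun _ _ => by ring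

/-- Markov's inequality for the exponential process. The horizon `t` is fixed, so the weights `β *
(P ^ (t - τ)) k d` are deterministic although they change with `t`. -/
lemma measure_le_exp (P : Matrix (Fin M) (Fin M) ℝ) (hsub : ∀ i, IsSubGaussian (p i) (m i) σ)
    (hlaw : ∀ t k i, HasLaw (r (t + 1) k i) (p i) μ)
    (hadapted : ∀ t k i, Measurable[ℱ (t + 1)] (r (t + 1) k i))
    (hpast : ∀ t, Indep
      (MeasurableSpace.comap (fun ω k i => r (t + 1) k i ω) inferInstance) (ℱ t) μ)
    (hagents : ∀ t i, iIndepFun (fun k => r (t + 1) k i) μ)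
    (hprev : ∀ t k, Measurable[ℱ t] (arm (t + 1) k)) (i : Fin N) (t : ℕ) (k : Fin M) (β c : ℝ) :
    μ.real {ω | c ≤ β * (sHat P (fun t k => arm t k ω) (fun t k i => r t k i ω) i t k
        - m i * nHat P (fun t k => arm t k ω) i t k)
      - β ^ 2 * σ ^ 2 * sqWeight P (fun t k => arm t k ω) i t k / 2} ≤ Real.exp (-c) := by
  have h := lintegral_exp_sum_le_one hsub hlaw hadapted hpast hagents hprev i
    (fun τ d => β * (P ^ (t - τ)) k d) t
  have heq : ∀ ω, β * (sHat P (fun t k => arm t k ω) (fun t k i => r t k i ω) i t k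
        - m i * nHat P (fun t k => arm t k ω) i t k)
      - β ^ 2 * σ ^ 2 * sqWeight P (fun t k => arm t k ω) i t k / 2
      = ∑ τ ∈ Finset.range t, ∑ d, selInd (fun t k => arm t k ω) i τ d *
        (β * (P ^ (t - τ)) k d * (r (τ + 1) d i ω - m i)
          - σ ^ 2 * (β * (P ^ (t - τ)) k d) ^ 2 / 2) := by
    intro ω
    simp_rw [sHat_sub_eq_sum, sqWeight, mul_div_assoc, Finset.sum_div, Finset.mul_sum,
      ← Finset.sum_sub_distrib]
    exact Finset.sum_congr rfl fun _ _ => Finset.sum_congr rfl fun _ _ => by ring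
  simp_rw [heq]
  have hm : Measurable fun ω => ENNReal.ofReal (Real.exp (∑ τ ∈ Finset.range t, ∑ d,
      selInd (fun t k => arm t k ω) i τ d * (β * (P ^ (t - τ)) k d * (r (τ + 1) d i ω - m i)
          - σ ^ 2 * (β * (P ^ (t - τ)) k d) ^ 2 / 2))) := by
    refine (ENNReal.measurable_ofReal.comp Real.measurable_exp).comp ?_
    refine Finset.measurable_fun_sum _ fun τ _ => Finset.measurable_fun_sum _ fun d _ => ?_
    exact ((measurable_selInd hprev i τ d).mono (ℱ.le _) le_rfl).mul
      (((((hadapted τ d i).mono (ℱ.le _) le_rfl).sub_const _).const_mul _).sub_const _)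
  have h2 := (mul_meas_ge_le_lintegral hm (μ := μ) (ENNReal.ofReal (Real.exp c))).trans h
  have hset : ∀ y : ℝ, ENNReal.ofReal (Real.exp c) ≤ ENNReal.ofReal (Real.exp y) ↔ c ≤ y :=
    fun y => by rw [ENNReal.ofReal_le_ofReal_iff (Real.exp_nonneg _), Real.exp_le_exp]
  simp_rw [hset] at h2
  have h3 := ENNReal.toReal_mono ENNReal.one_ne_top h2
  rw [ENNReal.toReal_mul, ENNReal.toReal_ofReal (Real.exp_nonneg _), ENNReal.toReal_one] at h3
  rw [Real.exp_neg, ← one_div, le_div_iff₀' (Real.exp_pos _)]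
  exact h3

end Supermartingale

/-! ### Peeling -/

/-- The optimal tilt depends on the random `W`, which is known only up to the factor `1 + η`. A tilt
fixed for the whole layer misjudges `√W` by a relative error of at most `η / 4`, and the factor `1 -
η² / 16` pays for this. -/
lemma peeling_le {η σ c a V W S : ℝ} (hη0 : 0 < η) (hη4 : η < 4) (hσ : 0 < σ) (hc : 0 ≤ c)
    (ha : 0 < a) (haW : a ≤ W) (hWa : W ≤ (1 + η) * a) (hVW : V ≤ W)
    (hS : σ * Real.sqrt (2 * c / (1 - η ^ 2 / 16) * W) ≤ S) :
    let β := Real.sqrt (2 * c / (1 - η ^ 2 / 16)) /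
      (σ * ((1 + Real.sqrt (1 + η)) / 2 * Real.sqrt a))
    c ≤ β * S - β ^ 2 * σ ^ 2 * V / 2 := by
  intro β
  have hG : 0 < 1 - η ^ 2 / 16 := by nlinarith
  set g := Real.sqrt (2 * c / (1 - η ^ 2 / 16))
  have hg2 : g ^ 2 = 2 * c / (1 - η ^ 2 / 16) := Real.sq_sqrt (by positivity)
  set q := Real.sqrt (1 + η)
  have hq2 : q ^ 2 = 1 + η := Real.sq_sqrt (by positivity)
  have hq1 : 1 < q := by
    rw [← Real.sqrt_one]; exact Real.sqrt_lt_sqrt zero_le_one (by linarith)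
  have hsa : 0 < Real.sqrt a := Real.sqrt_pos.mpr ha
  -- `v` is the midpoint of `√a` and `√((1 + η) a)`, the range of `√W`.
  set v := (1 + q) / 2 * Real.sqrt a
  have hv : 0 < v := by positivity
  have hW0 : 0 ≤ W := ha.le.trans haW
  have hβ : β = g / (σ * v) := rfl
  have hβ0 : 0 ≤ β := by rw [hβ]; positivity
  set x := Real.sqrt W / v with hx
  have hxW : x ^ 2 * v ^ 2 = W := by
    rw [← mul_pow, hx, div_mul_cancel₀ _ hv.ne', Real.sq_sqrt hW0]
  have h1 : Real.sqrt a ≤ Real.sqrt W := Real.sqrt_le_sqrt haW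
  have h2 : Real.sqrt W ≤ q * Real.sqrt a := by
    rw [← Real.sqrt_mul (by positivity)]; exact Real.sqrt_le_sqrt hWa
  -- With `η = q² - 1`, both bounds on `x` reduce to `(q - 1)² (q + 3) ≥ 0`.
  have hx1 : 1 - η / 4 ≤ x := by
    rw [hx, le_div_iff₀ hv]
    refine le_trans ?_ h1
    calc (1 - η / 4) * v = ((1 - η / 4) * ((1 + q) / 2)) * Real.sqrt a := by ring
      _ ≤ 1 * Real.sqrt a := by gcongr; nlinarith [sq_nonneg (q - 1)]
      _ = _ := one_mul _
  have hx2 : x ≤ 1 + η / 4 := by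
    rw [hx, div_le_iff₀ hv]
    refine h2.trans ?_
    calc q * Real.sqrt a ≤ ((1 + η / 4) * ((1 + q) / 2)) * Real.sqrt a := by
          gcongr; nlinarith [sq_nonneg (q - 1)]
      _ = _ := by ring
  have hβS : g ^ 2 * x ≤ β * S := by
    calc g ^ 2 * x = β * (σ * (g * Real.sqrt W)) := by rw [hβ, hx]; field_simp
      _ ≤ β * S := by
        gcongr
        rwa [← Real.sqrt_mul (by positivity)]
  have hβV : β ^ 2 * σ ^ 2 * V / 2 ≤ g ^ 2 * x ^ 2 / 2 := by
    calc β ^ 2 * σ ^ 2 * V / 2 ≤ β ^ 2 * σ ^ 2 * W / 2 := by gcongr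
      _ = _ := by rw [← hxW, hβ]; field_simp
  have hcg : c = g ^ 2 * ((1 - η ^ 2 / 16) / 2) := by
    rw [hg2, div_mul_div_comm, eq_div_iff (by positivity)]; ring
  -- The right side is `(1 - (x - 1)²) / 2`, and `|x - 1| ≤ η / 4`.
  have : (1 - η ^ 2 / 16) / 2 ≤ x - x ^ 2 / 2 := by nlinarith
  calc c = g ^ 2 * ((1 - η ^ 2 / 16) / 2) := hcg
    _ ≤ g ^ 2 * (x - x ^ 2 / 2) := by gcongr
    _ ≤ _ := by linarith

/-! ### Deviations of the estimated means -/

section Deviation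

lemma Params.Admissible.G_pos {θ : Params} (hθ : θ.Admissible) : 0 < θ.G := by
  have h1 := hθ.η_pos
  have h2 := hθ.η_lt
  unfold Params.G
  nlinarith

variable {M N : ℕ} [NeZero M] {P : Matrix (Fin M) (Fin M) ℝ} {lam : Fin M → ℝ}
  {u : Fin M → Fin M → ℝ} {θ : Params}
  {p : Fin N → Measure ℝ} [∀ i, IsProbabilityMeasure (p i)] {m : Fin N → ℝ}
  {Ω : Type*} {mΩ : MeasurableSpace Ω} {μ : Measure Ω} [IsProbabilityMeasure μ]
  {ℱ : Filtration ℕ mΩ} {r : ℕ → Fin M → Fin N → Ω → ℝ} {arm : ℕ → Fin M → Ω → Fin N}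

/-- A one-sided deviation of the estimated mean by more than the confidence width is unlikely. -/
lemma IsModalDecomposition.measure_deviation_le (h : IsModalDecomposition P lam u)
    (hP : ∀ i j, 0 ≤ P i j) (hP1 : P.mulVec 1 = 1) (hlam : ∀ p, p ≠ 0 → |lam p| < 1)
    (hMN : M ≤ N) (hN : 2 ≤ N) (hθ : θ.Admissible)
    (hsub : ∀ i, IsSubGaussian (p i) (m i) θ.σg)
    (hlaw : ∀ t k i, HasLaw (r (t + 1) k i) (p i) μ)
    (hadapted : ∀ t k i, Measurable[ℱ (t + 1)] (r (t + 1) k i))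
    (hpast : ∀ t, Indep
      (MeasurableSpace.comap (fun ω k i => r (t + 1) k i ω) inferInstance) (ℱ t) μ)
    (hagents : ∀ t i, iIndepFun (fun k => r (t + 1) k i) μ)
    (hprev : ∀ t k, Measurable[ℱ t] (arm (t + 1) k))
    (halg : ∀ ω, IsSelectiveLearning P θ (fun t k => arm t k ω) (fun t k i => r t k i ω))
    (i : Fin N) {t : ℕ} (ht : N ≤ t) {k : Fin M} (hf : epsC lam u k ≤ θ.f t)
    {s : ℝ} (hs : s ^ 2 = 1) :
    μ.real {ω | θ.σg * Real.sqrt (2 * θ.γ / θ.G *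
        ((nHat P (fun t k => arm t k ω) i t k + θ.f t) / M) * Real.log t)
      ≤ s * (sHat P (fun t k => arm t k ω) (fun t k i => r t k i ω) i t k
        - m i * nHat P (fun t k => arm t k ω) i t k)}
      ≤ (Real.log (t * (1 + epsN lam)) / Real.log (1 + θ.η) + 1) * (t : ℝ) ^ (-θ.γ) := by
  have hM0 : (0 : ℝ) < M := by exact_mod_cast Nat.pos_of_neZero M
  have ht2 : (2 : ℝ) ≤ t := by exact_mod_cast hN.trans ht
  have hlogt : 0 < Real.log t := Real.log_pos (by linarith)
  have hη := hθ.η_pos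
  have hlogη : 0 < Real.log (1 + θ.η) := Real.log_pos (by linarith)
  have hε := epsN_nonneg hlam
  have hG := hθ.G_pos
  have hγ : 0 < θ.γ := zero_lt_one.trans hθ.one_lt_γ
  set c := θ.γ * Real.log t with hc
  have hc0 : 0 ≤ c := by positivity
  set ρ := Real.log (t * (1 + epsN lam)) / Real.log (1 + θ.η) with hρ
  have hρ0 : 0 ≤ ρ := div_nonneg (Real.log_nonneg (by nlinarith)) hlogη.le
  set β : ℕ → ℝ := fun l => Real.sqrt (2 * c / (1 - θ.η ^ 2 / 16)) /
      (θ.σg * ((1 + Real.sqrt (1 + θ.η)) / 2 * Real.sqrt ((1 + θ.η) ^ l / M))) with hβ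
  set E : ℕ → Set Ω := fun l =>
    {ω | c ≤ (s * β l) * (sHat P (fun t k => arm t k ω) (fun t k i => r t k i ω) i t k
        - m i * nHat P (fun t k => arm t k ω) i t k)
      - (s * β l) ^ 2 * θ.σg ^ 2 * sqWeight P (fun t k => arm t k ω) i t k / 2} with hE
  have hcover : {ω | θ.σg * Real.sqrt (2 * θ.γ / θ.G *
        ((nHat P (fun t k => arm t k ω) i t k + θ.f t) / M) * Real.log t)
      ≤ s * (sHat P (fun t k => arm t k ω) (fun t k i => r t k i ω) i t k
        - m i * nHat P (fun t k => arm t k ω) i t k)} ⊆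
      ⋃ l ∈ Finset.range (⌊ρ⌋₊ + 1), E l := by
    intro ω hω
    simp only [Set.mem_ofPred_eq] at hω
    set A : ℕ → Fin M → Fin N := fun t k => arm t k ω
    set R : ℕ → Fin M → Fin N → ℝ := fun t k i => r t k i ω
    obtain ⟨e, he, heN, hei⟩ := (halg ω).exists_injective hMN i
    have h1 := h.one_le_nHat_add hP hP1 hlam A i he (fun d => (heN d).trans_le ht) hei k
    have h2 := h.mul_sqWeight_le hP1 hlam A i t k
    have h3 := h.mul_sqWeight_le_time hP hP1 hlam A i (hMN.trans ht) k
    -- The maximum with 1 keeps the layers at nonnegative powers of `1 + η` when the squared weights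
    -- are small. Both arguments stay below `nHat + f t`.
    set W := max (M * sqWeight P A i t k) 1
    have hW1 : 1 ≤ W := le_max_right _ _
    obtain ⟨l, hl1, hl2⟩ := exists_nat_pow_near hW1 (by linarith : 1 < 1 + θ.η)
    have hWt : W ≤ t * (1 + epsN lam) := max_le h3 (by nlinarith)
    have hWf : W ≤ nHat P A i t k + θ.f t :=
      max_le (h2.trans (by linarith)) (h1.trans (by linarith))
    refine Set.mem_biUnion (x := l) ?_ ?_
    · rw [SetLike.mem_coe, Finset.mem_range, Nat.lt_succ_iff]
      refine Nat.le_floor ?_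
      rw [hρ, le_div_iff₀ hlogη, ← Real.log_pow]
      exact Real.log_le_log (by positivity) (hl1.trans hWt)
    · have hpeel := peeling_le (V := sqWeight P A i t k) (W := W / M)
        (S := s * (sHat P A R i t k - m i * nHat P A i t k))
        hη hθ.η_lt hθ.σg_pos hc0 (a := (1 + θ.η) ^ l / M) (by positivity) (by gcongr)
        (by
          rw [← mul_div_assoc, ← pow_succ']
          gcongr)
        (by rw [le_div_iff₀' hM0]; exact le_max_left _ _)
        (by
          refine le_trans ?_ hω
          gcongr θ.σg * Real.sqrt ?_
          · exact hθ.σg_pos.le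
          calc 2 * c / (1 - θ.η ^ 2 / 16) * (W / M) = 2 * θ.γ / θ.G * (W / M) * Real.log t := by
                rw [hc, Params.G]; ring
            _ ≤ _ := by gcongr)
      -- Replacing `β` by `s * β` handles both tails at once, since `s² = 1` leaves the quadratic
      -- term unchanged.
      refine hpeel.trans (le_of_eq ?_)
      rw [mul_pow, hs, one_mul]
      simp only [hβ]
      ring
  calc _ ≤ μ.real (⋃ l ∈ Finset.range (⌊ρ⌋₊ + 1), E l) :=
        measureReal_mono hcover (measure_ne_top _ _)
    _ ≤ ∑ l ∈ Finset.range (⌊ρ⌋₊ + 1), μ.real (E l) := measureReal_biUnion_finset_le _ _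
    _ ≤ ∑ _l ∈ Finset.range (⌊ρ⌋₊ + 1), Real.exp (-c) := Finset.sum_le_sum fun l _ =>
        measure_le_exp P hsub hlaw hadapted hpast hagents hprev i t k (s * β l) c
    _ = (⌊ρ⌋₊ + 1) * (t : ℝ) ^ (-θ.γ) := by
        rw [Finset.sum_const, Finset.card_range, nsmul_eq_mul, Nat.cast_succ,
          Real.rpow_def_of_pos (by linarith), hc]
        ring_nf
    _ ≤ _ := by
        gcongr
        exact Nat.floor_le hρ0

end Deviation

/-! ### Two series -/

section Series

/-- Discrete form of comparing a decreasing function with its integral; the right side telescopes.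
-/
lemma rpow_neg_le_sub {a t : ℝ} (ha : 0 < a) (ht : 1 < t) :
    t ^ (-(a + 1)) ≤ ((t - 1) ^ (-a) - t ^ (-a)) / a := by
  have ht0 : 0 < t := by linarith
  have hx : 0 < 1 - 1 / t := by
    rw [sub_pos, div_lt_one ht0]; exact ht
  have h1 : 1 + a / t ≤ (1 - 1 / t) ^ (-a) := by
    rw [Real.rpow_def_of_pos hx]
    refine le_trans ?_ (Real.add_one_le_exp _)
    have := Real.log_le_sub_one_of_pos hx
    have h2 : a / t = a * (1 / t) := by ring
    rw [h2]
    nlinarith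
  have h2 : (t - 1) ^ (-a) = t ^ (-a) * (1 - 1 / t) ^ (-a) := by
    rw [← Real.mul_rpow ht0.le hx.le]
    congr 1
    field_simp
  have h3 : t ^ (-(a + 1)) = t ^ (-a) / t := by
    rw [neg_add, Real.rpow_add ht0, Real.rpow_neg_one, div_eq_mul_inv]
  rw [le_div_iff₀ ha, h2, h3]
  have h4 : 0 < t ^ (-a) := Real.rpow_pos_of_pos ht0 _
  calc t ^ (-a) / t * a = t ^ (-a) * (1 + a / t) - t ^ (-a) := by ring
    _ ≤ _ := by gcongr

lemma sum_rpow_neg_le {γ : ℝ} (hγ : 1 < γ) (n : ℕ) :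
    ∑ t ∈ Finset.Ico 2 n, (t : ℝ) ^ (-γ) ≤ 1 / (γ - 1) := by
  have ha : 0 < γ - 1 := by linarith
  rcases le_or_gt n 2 with hn | hn
  · rw [Finset.Ico_eq_empty_of_le hn, Finset.sum_empty]; positivity
  suffices h : ∑ t ∈ Finset.Ico 2 n, (t : ℝ) ^ (-γ) ≤
      (1 - ((n : ℝ) - 1) ^ (-(γ - 1))) / (γ - 1) by
    refine h.trans ?_
    have : (0 : ℝ) ≤ ((n : ℝ) - 1) ^ (-(γ - 1)) := by
      have : (2 : ℝ) < n := by exact_mod_cast hn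
      exact Real.rpow_nonneg (by linarith) _
    gcongr
    linarith
  induction n, hn.le using Nat.le_induction with
  | base => norm_num at hn
  | succ n hn' ih =>
    have h2 : (2 : ℝ) ≤ n := by exact_mod_cast hn'
    have h1 := rpow_neg_le_sub ha (t := n) (by linarith)
    rw [sub_add_cancel] at h1
    rw [Finset.sum_Ico_succ_top hn']
    have h3 : ∑ t ∈ Finset.Ico 2 n, (t : ℝ) ^ (-γ) ≤
        (1 - ((n : ℝ) - 1) ^ (-(γ - 1))) / (γ - 1) := by
      rcases hn'.eq_or_lt with rfl | h
      · norm_num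
      · exact ih h
    have h4 : ((n + 1 : ℕ) : ℝ) - 1 = n := by push_cast; ring
    rw [h4]
    calc _ ≤ (1 - ((n : ℝ) - 1) ^ (-(γ - 1))) / (γ - 1) +
          (((n : ℝ) - 1) ^ (-(γ - 1)) - (n : ℝ) ^ (-(γ - 1))) / (γ - 1) := add_le_add h3 h1
      _ = _ := by ring

/-- The exact antiderivative of `log t * t ^ (-(a + 1))` is `-(log t + 1 / a) * t ^ (-a) / a`. The
larger constant `1 / 2 + 3 / (2 * a)` absorbs the discretization error, using `log t - log (t - 1) ≤
1 / (t - 1) ≤ 1 / 2`. -/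
lemma log_mul_rpow_neg_le_sub {a t : ℝ} (ha : 0 < a) (ht : 3 ≤ t) :
    Real.log t * t ^ (-(a + 1)) ≤
      (Real.log (t - 1) + (1 / 2 + 3 / (2 * a))) * (t - 1) ^ (-a) / a
      - (Real.log t + (1 / 2 + 3 / (2 * a))) * t ^ (-a) / a := by
  have ht0 : 0 < t := by linarith
  have ht1 : 0 < t - 1 := by linarith
  set c := 1 / 2 + 3 / (2 * a) with hc
  have hkey := rpow_neg_le_sub ha (by linarith : 1 < t)
  set y := t ^ (-(a + 1)) with hy
  have hy0 : 0 < y := Real.rpow_pos_of_pos ht0 _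
  have hty : t ^ (-a) = t * y := by
    rw [hy, neg_add, Real.rpow_add ht0, Real.rpow_neg_one]; field_simp
  have hlog : Real.log t - Real.log (t - 1) ≤ 1 / (t - 1) := by
    rw [← Real.log_div ht0.ne' ht1.ne']
    refine (Real.log_le_sub_one_of_pos (by positivity)).trans (le_of_eq ?_)
    field_simp
    ring
  have h12 : 1 / (t - 1) ≤ 1 / 2 := one_div_le_one_div_of_le (by norm_num) (by linarith)
  have hlog0 : 0 ≤ Real.log (t - 1) := Real.log_nonneg (by linarith)
  have h1 : (Real.log (t - 1) + c) * y ≤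
      (Real.log (t - 1) + c) * (((t - 1) ^ (-a) - t ^ (-a)) / a) := by gcongr
  have h2 : (Real.log t - Real.log (t - 1)) * t ^ (-a) / a ≤ 3 / (2 * a) * y := by
    rw [hty]
    calc (Real.log t - Real.log (t - 1)) * (t * y) / a ≤ 1 / (t - 1) * (t * y) / a := by gcongr
      _ = (1 + 1 / (t - 1)) * y / a := by field_simp; ring
      _ ≤ (1 + 1 / 2) * y / a := by gcongr
      _ = _ := by field_simp; ring
  calc Real.log t * y ≤ (Real.log (t - 1) + 1 / 2) * y := by gcongr; linarith
    _ = (Real.log (t - 1) + c) * y - 3 / (2 * a) * y := by rw [hc]; ring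
    _ ≤ (Real.log (t - 1) + c) * (((t - 1) ^ (-a) - t ^ (-a)) / a)
        - (Real.log t - Real.log (t - 1)) * t ^ (-a) / a := sub_le_sub h1 h2
    _ = _ := by ring

lemma sum_log_mul_rpow_neg_le {γ : ℝ} (hγ : 1 < γ) (n : ℕ) :
    ∑ t ∈ Finset.Ico 2 n, Real.log t * (t : ℝ) ^ (-γ) ≤ 2 * (1 / (γ - 1) ^ 2 + 1) := by
  have ha : 0 < γ - 1 := by linarith
  set a := γ - 1 with ha'
  have hγa : γ = a + 1 := by rw [ha']; ring
  set c := 1 / 2 + 3 / (2 * a) with hc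
  rcases le_or_gt n 2 with hn | hn
  · rw [Finset.Ico_eq_empty_of_le hn, Finset.sum_empty]; positivity
  have hbound : ∑ t ∈ Finset.Ico 2 n, Real.log t * (t : ℝ) ^ (-γ) ≤
      Real.log 2 * (2 : ℝ) ^ (-γ) + (Real.log 2 + c) * 2 ^ (-a) / a
        - (Real.log ((n : ℝ) - 1) + c) * ((n : ℝ) - 1) ^ (-a) / a := by
    induction n, (Nat.succ_le_of_lt hn) using Nat.le_induction with
    | base => norm_num
    | succ n hn' ih =>
      have h3 : (3 : ℝ) ≤ n := by exact_mod_cast hn'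
      have h1 := log_mul_rpow_neg_le_sub ha h3
      rw [← hγa] at h1
      rw [Finset.sum_Ico_succ_top (by omega)]
      have h4 : ((n + 1 : ℕ) : ℝ) - 1 = n := by push_cast; ring
      rw [h4]
      linarith [ih (by omega)]
  have hn2 : (2 : ℝ) < n := by exact_mod_cast hn
  have hlast : 0 ≤ (Real.log ((n : ℝ) - 1) + c) * ((n : ℝ) - 1) ^ (-a) / a := by
    have : 0 ≤ Real.log ((n : ℝ) - 1) := Real.log_nonneg (by linarith)
    have : 0 ≤ ((n : ℝ) - 1) ^ (-a) := Real.rpow_nonneg (by linarith) _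
    positivity
  have hl2 : Real.log 2 ≤ 7 / 10 := by linarith [Real.log_two_lt_d9]
  have hl0 : 0 < Real.log 2 := Real.log_pos (by norm_num)
  have h2γ : (2 : ℝ) ^ (-γ) ≤ 1 / 2 := by
    calc (2 : ℝ) ^ (-γ) ≤ 2 ^ (-1 : ℝ) :=
          Real.rpow_le_rpow_of_exponent_le (by norm_num) (by linarith)
      _ = 1 / 2 := by rw [Real.rpow_neg_one]; norm_num
  have h2a : (2 : ℝ) ^ (-a) ≤ 1 := Real.rpow_le_one_of_one_le_of_nonpos (by norm_num) (by linarith)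
  have h1 : Real.log 2 * (2 : ℝ) ^ (-γ) ≤ 7 / 10 * (1 / 2) := by gcongr
  have h2 : (Real.log 2 + c) * 2 ^ (-a) / a ≤ (7 / 10 + c) * 1 / a := by gcongr
  have h3 : (7 / 10 + c) * 1 / a = 6 / 5 * (1 / a) + 3 / 2 * (1 / a) ^ 2 := by
    rw [hc]; field_simp; ring
  have h5 : 1 / a ^ 2 = (1 / a) ^ 2 := by rw [one_div_pow]
  rw [h5]
  -- With `x = 1 / a`, what remains is `7 / 20 + 6 / 5 x + 3 / 2 x² ≤ 2 x² + 2`, and `x² / 2 - 6 / 5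
  -- x` is at least `-18 / 25`.
  nlinarith [sq_nonneg (1 / a - 6 / 5)]

end Series

/-! ### Gaps -/

section Gaps

variable {N : ℕ} {m : Fin N → ℝ}

lemma gapMin_le {i j : Fin N} (hij : i ≠ j) : gapMin m ≤ |m i - m j| :=
  ciInf_le (f := fun q : {q : Fin N × Fin N // q.1 ≠ q.2} => |m q.1.1 - m q.1.2|)
    (Set.finite_range _).bddBelow ⟨(i, j), hij⟩

lemma gapMin_le_sub {i j : Fin N} (hij : m j < m i) : gapMin m ≤ m i - m j := by
  rw [← abs_of_pos (sub_pos.mpr hij)]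
  exact gapMin_le fun h => hij.ne (by rw [h])

lemma gapMin_pos (hN : 2 ≤ N) (hm : Function.Injective m) : 0 < gapMin m := by
  have : Nonempty {q : Fin N × Fin N // q.1 ≠ q.2} :=
    ⟨⟨(⟨0, by omega⟩, ⟨1, by omega⟩), by simp⟩⟩
  obtain ⟨q, hq⟩ := exists_eq_ciInf_of_finite
    (f := fun q : {q : Fin N × Fin N // q.1 ≠ q.2} => |m q.1.1 - m q.1.2|)
  rw [gapMin, ← hq]
  exact abs_pos.mpr (sub_ne_zero.mpr fun h => q.2 (hm h))

variable {b : Equiv.Perm (Fin N)} (hb : StrictAnti fun n => m (b n))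

include hb

lemma injective_of_strictAnti_comp : Function.Injective m := by
  have h : Function.Injective ((m ∘ b) ∘ b.symm) := hb.injective.comp b.symm.injective
  simpa [Function.comp_assoc] using h

/-- Pigeonhole: if `O` contained all of the `n + 1` best arms it would equal that set, which has no
room for `i`. -/
lemma exists_notMem_le {O : Finset (Fin N)} {n i : Fin N} (hO : O.card = n + 1) (hi : i ∈ O)
    (hin : m i < m (b n)) : ∃ j ∉ O, m (b n) ≤ m j := by
  by_contra! hcon
  have hsub : (Finset.Iic n).map b.toEmbedding ⊆ O := by
    intro x hx
    obtain ⟨l, hl, rfl⟩ := Finset.mem_map.mp hx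
    by_contra hx
    exact absurd (hb.antitone (Finset.mem_Iic.mp hl)) (not_le.mpr (hcon _ hx))
  have heq := Finset.eq_of_subset_of_card_le hsub (by simp [hO])
  rw [← heq] at hi
  obtain ⟨l, hl, rfl⟩ := Finset.mem_map.mp hi
  exact absurd (hb.antitone (Finset.mem_Iic.mp hl)) (not_le.mpr hin)

/-- Only `n` arms are strictly better than `b n`, too few to fill `O`. -/
lemma exists_mem_le {O : Finset (Fin N)} {n : Fin N} (hO : O.card = n + 1) :
    ∃ j ∈ O, m j ≤ m (b n) := by
  by_contra! hcon
  have hsub : O ⊆ (Finset.Iio n).map b.toEmbedding := by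
    intro x hx
    refine Finset.mem_map.mpr ⟨b.symm x, ?_, by simp⟩
    rw [Finset.mem_Iio, ← hb.lt_iff_gt]
    simpa using hcon x hx
  have := Finset.card_le_card hsub
  simp [hO] at this

end Gaps

/-! ### Selections in the absence of deviations -/

section Selection

variable {M N : ℕ} {P : Matrix (Fin M) (Fin M) ℝ} {θ : Params} {m : Fin N → ℝ}
  {arm : ℕ → Fin M → Fin N} {r : ℕ → Fin M → Fin N → ℝ}

/-- The estimated mean of arm `i` deviates from the mean, in the direction `s = ±1`, by at least the
confidence width. -/
def Deviates (P : Matrix (Fin M) (Fin M) ℝ) (θ : Params) (m : Fin N → ℝ) (arm : ℕ → Fin M → Fin N)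
    (r : ℕ → Fin M → Fin N → ℝ) (t : ℕ) (k : Fin M) (s : ℝ) (i : Fin N) : Prop :=
  θ.σg * Real.sqrt (2 * θ.γ / θ.G * ((nHat P arm i t k + θ.f t) / M) * Real.log t)
    ≤ s * (sHat P arm r i t k - m i * nHat P arm i t k)

/-- Links the width to `Deviates`, whose form multiplied by `nHat` is meaningful also where `nHat`
vanishes. -/
lemma nHat_mul_width {i : Fin N} {t : ℕ} {k : Fin M} (hn : 0 < nHat P arm i t k) :
    nHat P arm i t k * width P θ arm i t k =
      θ.σg * Real.sqrt (2 * θ.γ / θ.G * ((nHat P arm i t k + θ.f t) / M) * Real.log t) := by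
  rw [width, mul_left_comm]
  congr 1
  nth_rewrite 1 [← Real.sqrt_sq hn.le]
  rw [← Real.sqrt_mul (sq_nonneg _)]
  congr 1
  field_simp

lemma lt_add_of_not_deviates {s : ℝ} {i : Fin N} {t : ℕ} {k : Fin M} (hn : 0 < nHat P arm i t k)
    (hdev : ¬ Deviates P θ m arm r t k s i) :
    s * (muHat P arm r i t k - m i) < width P θ arm i t k := by
  rw [Deviates, ← nHat_mul_width hn, not_le] at hdev
  have h : s * (sHat P arm r i t k - m i * nHat P arm i t k)
      = nHat P arm i t k * (s * (muHat P arm r i t k - m i)) := by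
    rw [muHat]; field_simp
  rw [h] at hdev
  exact lt_of_mul_lt_mul_left hdev hn.le

/-- An index below a finite upper index cannot be `⊤`, so the comparison arm has also been observed.
-/
lemma upperIndex_le_upperIndex {i j : Fin N} {t : ℕ} {k : Fin M} (hi : nHat P arm i t k ≠ 0)
    (hle : upperIndex P θ arm r j t k ≤ upperIndex P θ arm r i t k) :
    nHat P arm j t k ≠ 0 ∧ muHat P arm r j t k + width P θ arm j t k ≤
      muHat P arm r i t k + width P θ arm i t k := by
  unfold upperIndex at hle
  rw [if_neg hi] at hle
  split_ifs at hle with hj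
  · exact absurd (top_le_iff.mp hle) (EReal.coe_ne_top _)
  · exact ⟨hj, EReal.coe_le_coe_iff.mp hle⟩

lemma lowerIndex_le_lowerIndex {i j : Fin N} {t : ℕ} {k : Fin M} (hi : nHat P arm i t k ≠ 0)
    (hle : lowerIndex P θ arm r i t k ≤ lowerIndex P θ arm r j t k) :
    nHat P arm j t k ≠ 0 ∧ muHat P arm r i t k - width P θ arm i t k ≤
      muHat P arm r j t k - width P θ arm j t k := by
  unfold lowerIndex at hle
  rw [if_neg hi] at hle
  split_ifs at hle with hj
  · exact absurd (le_bot_iff.mp hle) (EReal.coe_ne_bot _)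
  · exact ⟨hj, EReal.coe_le_coe_iff.mp hle⟩

/-- The direction in which the estimate of arm `i` has to be wrong for agent `k` to select it
incorrectly: upwards if the arm is worse than the target, downwards if it is better. -/
def errorSign (m : Fin N → ℝ) (target i : Fin N) : ℝ := if m i < m target then 1 else -1

lemma errorSign_sq (target i : Fin N) : errorSign m target i ^ 2 = 1 := by
  unfold errorSign; split_ifs <;> norm_num

/-- If `i` is worse than the target, some excluded `j` is at least as good as the target, and `m j <
Q_j ≤ Q_i < m i + 2 C_i`. If `i` is better, some `j ∈ O` is no better than the target, and `m i - 2
C_i < W_i ≤ W_j < m j`. Either way `2 C_i` exceeds a gap. -/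
lemma IsSelectiveLearning.gapMin_le_width {b : Equiv.Perm (Fin N)}
    (h : IsSelectiveLearning P θ arm r) (hP : ∀ i j, 0 ≤ P i j)
    (hb : StrictAnti fun n => m (b n)) (hMN : M ≤ N) {t : ℕ} (ht : N ≤ t) {k : Fin M} {i : Fin N}
    (hik : b (Fin.castLE hMN k) ≠ i) (hsel : arm (t + 1) k = i) (hn : nHat P arm i t k ≠ 0)
    (hdev : ¬ Deviates P θ m arm r t k (errorSign m (b (Fin.castLE hMN k)) i) i)
    (hdevs : ∀ j, ¬ Deviates P θ m arm r t k (-errorSign m (b (Fin.castLE hMN k)) i) j) :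
    gapMin m ≤ 2 * width P θ arm i t k := by
  obtain ⟨O, hO, hQ, hiO, hW⟩ := h.selection t ht k
  rw [hsel] at hiO hW
  have hpos : ∀ {j}, nHat P arm j t k ≠ 0 → 0 < nHat P arm j t k := fun h0 =>
    (nHat_nonneg hP arm _ t k).lt_of_ne' h0
  have h1 := lt_add_of_not_deviates (hpos hn) hdev
  have hne : m i ≠ m (b (Fin.castLE hMN k)) := fun he =>
    hik (injective_of_strictAnti_comp hb he).symm
  rcases hne.lt_or_gt with hlt | hgt
  · obtain ⟨j, hjO, hj⟩ := exists_notMem_le hb (n := Fin.castLE hMN k) (by simpa using hO) hiO hlt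
    obtain ⟨hnj, hle⟩ := upperIndex_le_upperIndex hn (hQ i hiO j hjO)
    have h2 := lt_add_of_not_deviates (hpos hnj) (hdevs j)
    have hs : errorSign m (b (Fin.castLE hMN k)) i = 1 := if_pos hlt
    rw [hs] at h1 h2
    linarith [gapMin_le_sub (hlt.trans_le hj)]
  · obtain ⟨j, hjO, hj⟩ := exists_mem_le hb (n := Fin.castLE hMN k) (by simpa using hO)
    obtain ⟨hnj, hle⟩ := lowerIndex_le_lowerIndex hn (hW j hjO)
    have h2 := lt_add_of_not_deviates (hpos hnj) (hdevs j)
    have hs : errorSign m (b (Fin.castLE hMN k)) i = -1 := if_neg hgt.not_gt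
    rw [hs] at h1 h2
    linarith [gapMin_le_sub (hj.trans_lt hgt)]

/-- The leading term of the bound. -/
def leadingTerm (M : ℕ) (θ : Params) (m : Fin N → ℝ) (T : ℕ) : ℝ :=
  4 * θ.σg ^ 2 * θ.γ / (gapMin m ^ 2 * θ.G) *
    (1 + Real.sqrt (1 + gapMin m ^ 2 * M * θ.G / (2 * θ.σg ^ 2 * θ.γ) *
      (θ.f T / Real.log T))) * Real.log T

lemma leadingTerm_nonneg (hθ : θ.Admissible) {T : ℕ} (hT : 1 ≤ T) : 0 ≤ leadingTerm M θ m T := by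
  have hG := hθ.G_pos
  have hγ : 0 < θ.γ := zero_lt_one.trans hθ.one_lt_γ
  have hL : 0 ≤ Real.log T := Real.log_nonneg (by exact_mod_cast hT)
  unfold leadingTerm
  positivity

/-- The width condition is a quadratic inequality in `M * nHat`; the leading term, with its square
root, is the larger root once `t` is replaced by `T`. -/
lemma mul_nHat_le_leadingTerm [NeZero M] (hθ : θ.Admissible) (hgap : 0 < gapMin m) {i : Fin N}
    {k : Fin M} {t T : ℕ} (ht : 2 ≤ t) (htT : t ≤ T) (hn : 0 < nHat P arm i t k)
    (hw : gapMin m ≤ 2 * width P θ arm i t k) :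
    M * nHat P arm i t k ≤ leadingTerm M θ m T := by
  have hM0 : (0 : ℝ) < M := by exact_mod_cast Nat.pos_of_neZero M
  have hG := hθ.G_pos
  have hσ := hθ.σg_pos
  have hγ : 0 < θ.γ := zero_lt_one.trans hθ.one_lt_γ
  have ht2 : (2 : ℝ) ≤ t := by exact_mod_cast ht
  have htT' : (t : ℝ) ≤ T := by exact_mod_cast htT
  have hlt : 0 < Real.log t := Real.log_pos (by linarith)
  have hlT : Real.log t ≤ Real.log T := Real.log_le_log (by linarith) htT'
  have hL : 0 < Real.log T := hlt.trans_le hlT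
  have hft : 0 ≤ θ.f t := hθ.f_nonneg _ (by linarith)
  have hfT : θ.f t ≤ θ.f T := hθ.f_strictMono.monotoneOn
    (Set.mem_Ici.mpr (by linarith)) (Set.mem_Ici.mpr (by linarith)) htT'
  set Δ := gapMin m
  set n := nHat P arm i t k
  set L := Real.log T
  set F := θ.f T
  have hF : 0 ≤ F := hft.trans hfT
  set K := 4 * θ.σg ^ 2 * θ.γ / (Δ ^ 2 * θ.G) * L with hK
  have hK0 : 0 < K := by positivity
  have hnw : n * width P θ arm i t k =
      θ.σg * Real.sqrt (2 * θ.γ / θ.G * ((n + θ.f t) / M) * Real.log t) := nHat_mul_width hn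
  have h1 : (n * Δ) ^ 2 ≤ 4 * (θ.σg ^ 2 * (2 * θ.γ / θ.G * ((n + F) / M) * L)) := by
    calc (n * Δ) ^ 2 ≤ (2 * (n * width P θ arm i t k)) ^ 2 := by
          refine pow_le_pow_left₀ (by positivity) ?_ 2
          nlinarith
      _ = 4 * (θ.σg ^ 2 * (2 * θ.γ / θ.G * ((n + θ.f t) / M) * Real.log t)) := by
          rw [hnw, mul_pow, mul_pow, Real.sq_sqrt (by positivity)]; norm_num
      _ ≤ _ := by gcongr
  have h2 : (M * n) ^ 2 ≤ 2 * K * (M * n + M * F) := by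
    have e1 : (M * n) ^ 2 = (n * Δ) ^ 2 * (M ^ 2 / Δ ^ 2) := by field_simp
    have e2 : 2 * K * (M * n + M * F) =
        4 * (θ.σg ^ 2 * (2 * θ.γ / θ.G * ((n + F) / M) * L)) * (M ^ 2 / Δ ^ 2) := by
      rw [hK]; field_simp
    rw [e1, e2]
    gcongr
  have h3 : leadingTerm M θ m T = K + K * Real.sqrt (1 + 2 * M * F / K) := by
    have e : Δ ^ 2 * M * θ.G / (2 * θ.σg ^ 2 * θ.γ) * (F / L) = 2 * M * F / K := by
      rw [hK]; field_simp; ring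
    rw [leadingTerm, e, hK]; ring
  -- Completing the square in `h2`.
  have h4 : (M * n - K) ^ 2 ≤ K ^ 2 * (1 + 2 * M * F / K) := by
    have e : K ^ 2 * (1 + 2 * M * F / K) = K ^ 2 + 2 * K * M * F := by field_simp
    rw [e]
    nlinarith
  have h5 := Real.le_sqrt_of_sq_le h4
  rw [Real.sqrt_mul (sq_nonneg K), Real.sqrt_sq hK0.le] at h5
  rw [h3]
  linarith

/-! ### Counting selections along one sample path -/

lemma selections_le_add (arm : ℕ → Fin M → Fin N) (i : Fin N) (k : Fin M) (t T : ℕ) :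
    selections arm i k T ≤ selections arm i k t +
      ((Finset.Ico t T).filter fun τ => arm (τ + 1) k = i).card := by
  classical
  have hsub : (Finset.Icc 1 T).filter (fun τ => arm τ k = i) ⊆
      (Finset.Icc 1 t).filter (fun τ => arm τ k = i) ∪
      ((Finset.Ico t T).filter fun τ => arm (τ + 1) k = i).image (· + 1) := by
    intro τ hτ
    simp only [Finset.mem_filter, Finset.mem_Icc, Finset.mem_union, Finset.mem_image,
      Finset.mem_Ico] at hτ ⊢
    obtain ⟨⟨h1, h2⟩, h3⟩ := hτ
    by_cases hτt : τ ≤ t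
    · exact Or.inl ⟨⟨h1, hτt⟩, h3⟩
    · refine Or.inr ⟨τ - 1, ⟨⟨by omega, by omega⟩, ?_⟩, by omega⟩
      rwa [Nat.sub_add_cancel h1]
  refine (Finset.card_le_card hsub).trans ((Finset.card_union_le _ _).trans ?_)
  exact Nat.add_le_add_left Finset.card_image_le _

lemma IsSelectiveLearning.selections_initial_le (h : IsSelectiveLearning P θ arm r) (i : Fin N)
    (k : Fin M) : selections arm i k N ≤ 1 := by
  refine Finset.card_le_one.mpr fun t ht t' ht' => ?_
  simp only [Finset.mem_filter, Finset.mem_Icc] at ht ht'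
  have h1 := h.initialization t ht.1.1 ht.1.2 k
  have h2 := h.initialization t' ht'.1.1 ht'.1.2 k
  rw [ht.2] at h1
  rw [ht'.2] at h2
  have h3 : t - 1 ≡ t' - 1 [MOD N] := Nat.ModEq.add_right_cancel' _ (h1.symm.trans h2)
  rw [Nat.ModEq, Nat.mod_eq_of_lt (by omega), Nat.mod_eq_of_lt (by omega)] at h3
  omega

/-- Counting starts at 2 or later, so the rounding in `⌈x⌉₊ - 2` still stays below `x - 1`. -/
lemma card_filter_lt_le {x : ℝ} (hx : 1 ≤ x) {n : ℕ} (hn : 2 ≤ n) (s T : ℕ) (hs : n ≤ s) :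
    (((Finset.Ico s T).filter fun t : ℕ => (t : ℝ) < x).card : ℝ) ≤ x - 1 := by
  have hsub : (Finset.Ico s T).filter (fun t : ℕ => (t : ℝ) < x) ⊆ Finset.Ico 2 ⌈x⌉₊ := by
    intro t ht
    simp only [Finset.mem_filter, Finset.mem_Ico] at ht ⊢
    exact ⟨by omega, Nat.lt_ceil.mpr ht.2⟩
  have h1 := Finset.card_le_card hsub
  rw [Nat.card_Ico] at h1
  have h2 : ((⌈x⌉₊ - 2 : ℕ) : ℝ) ≤ x - 1 := by
    rcases le_or_gt 2 ⌈x⌉₊ with h | h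
    · rw [Nat.cast_sub h]
      have := Nat.ceil_lt_add_one (zero_le_one.trans hx)
      push_cast; linarith
    · rw [Nat.sub_eq_zero_of_le h.le]; simpa using hx
  exact le_trans (by exact_mod_cast h1) h2

open Classical in
/-- The number of deviations that can cause an incorrect selection of arm `i` by agent `k` at time
`t + 1`. -/
def deviationCount (P : Matrix (Fin M) (Fin M) ℝ) (θ : Params) (m : Fin N → ℝ)
    (arm : ℕ → Fin M → Fin N) (r : ℕ → Fin M → Fin N → ℝ) (target i : Fin N) (t : ℕ) (k : Fin M) :
    ℝ :=
  (if Deviates P θ m arm r t k (errorSign m target i) i then 1 else 0) +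
    ∑ j, if Deviates P θ m arm r t k (-errorSign m target i) j then 1 else 0

lemma deviationCount_nonneg (target i : Fin N) (t : ℕ) (k : Fin M) :
    0 ≤ deviationCount P θ m arm r target i t k := by
  unfold deviationCount
  refine add_nonneg (by split_ifs <;> simp) (Finset.sum_nonneg fun j _ => by split_ifs <;> simp)

lemma one_le_deviationCount {target i : Fin N} {t : ℕ} {k : Fin M}
    (h : Deviates P θ m arm r t k (errorSign m target i) i ∨
      ∃ j, Deviates P θ m arm r t k (-errorSign m target i) j) :
    1 ≤ deviationCount P θ m arm r target i t k := by
  classical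
  unfold deviationCount
  rcases h with h | ⟨j, h⟩
  · rw [if_pos h, le_add_iff_nonneg_right]
    exact Finset.sum_nonneg fun j _ => by split_ifs <;> simp
  · refine le_add_of_nonneg_of_le (by split_ifs <;> simp) ?_
    refine le_trans ?_ (Finset.single_le_sum (fun j _ => ?_) (Finset.mem_univ j))
    · rw [if_pos h]
    · split_ifs <;> simp

/-- The incorrect selections of arm `i` along one sample path. -/
lemma IsSelectiveLearning.sum_selections_le [NeZero M] {lam : Fin M → ℝ} {u : Fin M → Fin M → ℝ}
    {b : Equiv.Perm (Fin N)} (h : IsSelectiveLearning P θ arm r)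
    (hu : IsModalDecomposition P lam u) (hP : ∀ i j, 0 ≤ P i j) (hP1 : P.mulVec 1 = 1)
    (hlam : ∀ p, p ≠ 0 → |lam p| < 1) (hMN : M ≤ N) (hN : 2 ≤ N) (hθ : θ.Admissible)
    (hb : StrictAnti fun n => m (b n)) {tdag : Fin M → ℝ} (htdag : ∀ k, 1 ≤ tdag k) (i : Fin N)
    {T : ℕ} (hT : 1 ≤ T) :
    ∑ k ∈ Finset.univ.filter (fun k : Fin M => b (Fin.castLE hMN k) ≠ i),
        (selections arm i k T : ℝ) ≤
      leadingTerm M θ m T + M * (1 + epsN lam) + ∑ k, (tdag k - 1) +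
      ∑ k ∈ Finset.univ.filter (fun k : Fin M => b (Fin.castLE hMN k) ≠ i),
        ∑ t ∈ Finset.Ico N T, if tdag k ≤ t then
          deviationCount P θ m arm r (b (Fin.castLE hMN k)) i t k else 0 := by
  classical
  have hM0 : (0 : ℝ) < M := by exact_mod_cast Nat.pos_of_neZero M
  have hε := epsN_nonneg hlam
  have hgap := gapMin_pos hN (injective_of_strictAnti_comp hb)
  have hlead := leadingTerm_nonneg (M := M) (m := m) hθ hT
  set A := Finset.univ.filter (fun k : Fin M => b (Fin.castLE hMN k) ≠ i)
  -- `t₀` follows the last incorrect selection made while the selecting agent's `M * nHat` was at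
  -- most the leading term. Estimates at time `t` govern the selection at `t + 1`, so this last
  -- round adds up to `M` selections to the count at time `t`.
  obtain ⟨t₀, ht₀, hinit, hlate⟩ : ∃ t₀, N ≤ t₀ ∧
      ∑ k, (selections arm i k t₀ : ℝ) ≤ leadingTerm M θ m T + M * (1 + epsN lam) ∧
      ∀ t ∈ Finset.Ico t₀ T, ∀ k ∈ A, arm (t + 1) k = i →
        leadingTerm M θ m T < M * nHat P arm i t k := by
    by_cases hC : ((Finset.Ico N T).filter fun t =>
        ∃ k ∈ A, arm (t + 1) k = i ∧ M * nHat P arm i t k ≤ leadingTerm M θ m T).Nonempty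
    · set s := (Finset.Ico N T).filter fun t =>
        ∃ k ∈ A, arm (t + 1) k = i ∧ M * nHat P arm i t k ≤ leadingTerm M θ m T
      obtain ⟨hmem, k, -, -, hk⟩ := Finset.mem_filter.mp (s.max'_mem hC)
      rw [Finset.mem_Ico] at hmem
      refine ⟨s.max' hC + 1, by omega, ?_, fun t ht k hk hsel => ?_⟩
      · have h1 := hu.sum_selections_le hP1 hlam arm i (s.max' hC) k
        have h2 : ∀ k, (selections arm i k (s.max' hC + 1) : ℝ) ≤
            selections arm i k (s.max' hC) + 1 := by
          intro k
          have h3 := selections_le_add arm i k (s.max' hC) (s.max' hC + 1)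
          have h4 : ((Finset.Ico (s.max' hC) (s.max' hC + 1)).filter
              fun τ => arm (τ + 1) k = i).card ≤ 1 :=
            (Finset.card_filter_le _ _).trans (by simp)
          exact_mod_cast h3.trans (Nat.add_le_add_left h4 _)
        calc _ ≤ ∑ k, ((selections arm i k (s.max' hC) : ℝ) + 1) :=
              Finset.sum_le_sum fun k _ => h2 k
          _ = ∑ k, (selections arm i k (s.max' hC) : ℝ) + M := by
              rw [Finset.sum_add_distrib]; simp
          _ ≤ _ := by linarith
      · by_contra! hle
        rw [Finset.mem_Ico] at ht
        have : t ∈ s := Finset.mem_filter.mpr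
          ⟨Finset.mem_Ico.mpr ⟨by omega, ht.2⟩, k, hk, hsel, hle⟩
        have := s.le_max' t this
        omega
    -- With no such selection only the initialization is counted, one per agent. Here `N` may exceed
    -- `T`; the later interval is then empty.
    · refine ⟨N, le_rfl, ?_, fun t ht k hk hsel => ?_⟩
      · calc ∑ k, (selections arm i k N : ℝ) ≤ ∑ _k : Fin M, (1 : ℝ) :=
              Finset.sum_le_sum fun k _ => by exact_mod_cast h.selections_initial_le i k
          _ = M := by simp
          _ ≤ _ := by nlinarith
      · by_contra! hle
        exact hC ⟨t, Finset.mem_filter.mpr ⟨ht, k, hk, hsel, hle⟩⟩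
  have hagent : ∀ k ∈ A, (selections arm i k T : ℝ) ≤ selections arm i k t₀ + (tdag k - 1) +
      ∑ t ∈ Finset.Ico N T, if tdag k ≤ t then
          deviationCount P θ m arm r (b (Fin.castLE hMN k)) i t k else 0 := by
    intro k hk
    have hik : b (Fin.castLE hMN k) ≠ i := (Finset.mem_filter.mp hk).2
    have h1 : (selections arm i k T : ℝ) ≤ selections arm i k t₀ +
      ((Finset.Ico t₀ T).filter fun τ => arm (τ + 1) k = i).card := by
      exact_mod_cast selections_le_add arm i k t₀ T
    have h2 := card_filter_lt_le (htdag k) hN t₀ T ht₀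
    have hterm0 : ∀ t : ℕ, 0 ≤ if tdag k ≤ t then
        deviationCount P θ m arm r (b (Fin.castLE hMN k)) i t k else 0 := by
      intro t; split_ifs
      · exact deviationCount_nonneg _ _ _ _
      · exact le_rfl
    have h3 : (((Finset.Ico t₀ T).filter fun τ => arm (τ + 1) k = i).card : ℝ) ≤
        ((Finset.Ico t₀ T).filter fun t : ℕ => (t : ℝ) < tdag k).card +
        ∑ t ∈ Finset.Ico t₀ T, if tdag k ≤ t then
          deviationCount P θ m arm r (b (Fin.castLE hMN k)) i t k else 0 := by
      rw [Finset.card_filter, Finset.card_filter, Nat.cast_sum, Nat.cast_sum,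
        ← Finset.sum_add_distrib]
      refine Finset.sum_le_sum fun t ht => ?_
      have hNt : N ≤ t := ht₀.trans (Finset.mem_Ico.mp ht).1
      by_cases hsel : arm (t + 1) k = i
      · rcases lt_or_ge (t : ℝ) (tdag k) with hlt | hge
        · simpa [hsel, hlt] using hterm0 t
        · rw [if_pos hsel, if_neg hge.not_gt, if_pos hge]
          have hbig := hlate t ht k hk hsel
          -- Past the cut `nHat` exceeds a nonnegative bound, so the infinite index values of an
          -- unobserved arm `i` play no role.
          have hn : 0 < nHat P arm i t k := pos_of_mul_pos_right (hlead.trans_lt hbig) hM0.le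
          have hdev : 1 ≤ deviationCount P θ m arm r (b (Fin.castLE hMN k)) i t k := by
            refine one_le_deviationCount ?_
            by_contra! hcon
            have hw := h.gapMin_le_width hP hb hMN hNt hik hsel hn.ne' hcon.1 hcon.2
            exact absurd (mul_nHat_le_leadingTerm hθ hgap (hN.trans hNt)
              (Finset.mem_Ico.mp ht).2.le hn hw) (not_le.mpr hbig)
          simpa using hdev
      · rw [if_neg hsel, Nat.cast_zero]
        exact add_nonneg (Nat.cast_nonneg _) (hterm0 t)
    have h4 := Finset.sum_le_sum_of_subset_of_nonneg (Finset.Ico_subset_Ico_left ht₀ :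
      Finset.Ico t₀ T ⊆ Finset.Ico N T) fun t _ _ => hterm0 t
    linarith
  calc _ ≤ ∑ k ∈ A, (((selections arm i k t₀ : ℝ) + (tdag k - 1)) +
      ∑ t ∈ Finset.Ico N T, if tdag k ≤ t then
          deviationCount P θ m arm r (b (Fin.castLE hMN k)) i t k else 0) :=
        Finset.sum_le_sum hagent
    _ ≤ _ := by
        rw [Finset.sum_add_distrib]
        gcongr ?_ + _
        calc ∑ k ∈ A, ((selections arm i k t₀ : ℝ) + (tdag k - 1))
            ≤ ∑ k, ((selections arm i k t₀ : ℝ) + (tdag k - 1)) :=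
              Finset.sum_le_sum_of_subset_of_nonneg (Finset.subset_univ _) fun k _ _ =>
                add_nonneg (Nat.cast_nonneg _) (sub_nonneg.mpr (htdag k))
          _ = ∑ k, (selections arm i k t₀ : ℝ) + ∑ k, (tdag k - 1) := Finset.sum_add_distrib
          _ ≤ _ := by linarith

end Selection

/-! ### Expectations -/

section Expectation

variable {M N : ℕ} {P : Matrix (Fin M) (Fin M) ℝ} {θ : Params} {m : Fin N → ℝ}
  {Ω : Type*} {mΩ : MeasurableSpace Ω} {μ : Measure Ω} [IsProbabilityMeasure μ]
  {r : ℕ → Fin M → Fin N → Ω → ℝ} {arm : ℕ → Fin M → Ω → Fin N}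

lemma measurable_selInd_apply (harm : ∀ t k, Measurable (arm (t + 1) k)) (i : Fin N) (τ : ℕ)
    (d : Fin M) : Measurable fun ω => selInd (fun t k => arm t k ω) i τ d :=
  (measurable_of_finite fun a : Fin N => if a = i then (1 : ℝ) else 0).comp (harm τ d)

lemma measurableSet_deviates (harm : ∀ t k, Measurable (arm (t + 1) k))
    (hr : ∀ t k i, Measurable (r (t + 1) k i)) (t : ℕ) (k : Fin M) (s : ℝ) (i : Fin N) :
    MeasurableSet {ω | Deviates P θ m (fun t k => arm t k ω) (fun t k i => r t k i ω) t k s i} := by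
  have h1 : Measurable fun ω => nHat P (fun t k => arm t k ω) i t k := by
    simp_rw [nHat_eq_sum]
    exact Finset.measurable_fun_sum _ fun τ _ => Finset.measurable_fun_sum _ fun d _ =>
      (measurable_selInd_apply harm i τ d).const_mul _
  have h2 : Measurable fun ω => sHat P (fun t k => arm t k ω) (fun t k i => r t k i ω) i t k := by
    simp_rw [sHat_eq_sum]
    exact Finset.measurable_fun_sum _ fun τ _ => Finset.measurable_fun_sum _ fun d _ =>
      ((measurable_selInd_apply harm i τ d).mul (hr τ d i)).const_mul _
  unfold Deviates
  exact measurableSet_le (by fun_prop) (by fun_prop)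

lemma integrable_ite_one {p : Ω → Prop} [DecidablePred p] (hp : MeasurableSet {ω | p ω}) :
    Integrable (fun ω => if p ω then (1 : ℝ) else 0) μ ∧
      ∫ ω, (if p ω then (1 : ℝ) else 0) ∂μ = μ.real {ω | p ω} := by
  have h : (fun ω => if p ω then (1 : ℝ) else 0) = {ω | p ω}.indicator 1 := by
    ext ω; simp [Set.indicator_apply]
  rw [h]
  exact ⟨(integrable_const (1 : ℝ)).indicator hp, integral_indicator_one hp⟩

lemma integral_deviationCount_le (harm : ∀ t k, Measurable (arm (t + 1) k))
    (hr : ∀ t k i, Measurable (r (t + 1) k i)) (target i : Fin N) (t : ℕ) (k : Fin M) {B : ℝ}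
    (hB : ∀ s j, s ^ 2 = 1 → μ.real {ω | Deviates P θ m (fun t k => arm t k ω)
      (fun t k i => r t k i ω) t k s j} ≤ B) :
    Integrable (fun ω => deviationCount P θ m (fun t k => arm t k ω) (fun t k i => r t k i ω)
        target i t k) μ ∧
      ∫ ω, deviationCount P θ m (fun t k => arm t k ω) (fun t k i => r t k i ω) target i t k ∂μ
        ≤ (N + 1) * B := by
  classical
  have h := fun s j => integrable_ite_one (μ := μ)
    (measurableSet_deviates (P := P) (θ := θ) (m := m) harm hr t k s j)
  have hs := errorSign_sq (m := m) target i
  have hint := integrable_finsetSum Finset.univ fun j _ => (h (-errorSign m target i) j).1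
  unfold deviationCount
  refine ⟨(h _ i).1.add hint, ?_⟩
  rw [integral_add (h _ i).1 hint, integral_finsetSum _ fun j _ => (h _ j).1, (h _ i).2]
  simp_rw [(h _ _).2]
  calc _ ≤ B + ∑ _j : Fin N, B := add_le_add (hB _ i hs)
        (Finset.sum_le_sum fun j _ => hB _ j (by rw [neg_sq, hs]))
    _ = (N + 1) * B := by simp; ring

lemma integrable_selections (harm : ∀ t k, Measurable (arm (t + 1) k)) (i : Fin N) (k : Fin M)
    (T : ℕ) : Integrable (fun ω => (selections (fun t k => arm t k ω) i k T : ℝ)) μ := by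
  have h : (fun ω => (selections (fun t k => arm t k ω) i k T : ℝ)) =
      fun ω => ∑ t ∈ Finset.Icc 1 T, if arm t k ω = i then (1 : ℝ) else 0 := by
    ext ω; simp [selections]
  rw [h]
  refine integrable_finsetSum _ fun t ht => (integrable_ite_one ?_).1
  obtain ⟨s, rfl⟩ := Nat.exists_eq_add_of_le' (Finset.mem_Icc.mp ht).1
  exact harm s k (measurableSet_singleton i)

/-- The additional layer `+ 1` is absorbed as `log (1 + η)` into `L`, leaving the two series already
bounded. -/
lemma sum_tail_le {γ η ε : ℝ} (hγ : 1 < γ) (hη : 0 < η) (hε : 0 ≤ ε) (n : ℕ) :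
    ∑ t ∈ Finset.Ico 2 n, (Real.log (t * (1 + ε)) / Real.log (1 + η) + 1) * (t : ℝ) ^ (-γ) ≤
      2 / Real.log (1 + η) *
        (1 / (γ - 1) ^ 2 + γ * Real.log ((1 + ε) * (1 + η)) / (γ - 1) + 1) := by
  have hlog : 0 < Real.log (1 + η) := Real.log_pos (by linarith)
  have ha : 0 < γ - 1 := by linarith
  set L := Real.log ((1 + ε) * (1 + η)) with hL
  have hL' : L = Real.log (1 + ε) + Real.log (1 + η) :=
    Real.log_mul (by positivity) (by positivity)
  have hL0 : 0 ≤ L := Real.log_nonneg (by nlinarith)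
  have hterm : ∀ t ∈ Finset.Ico 2 n,
      (Real.log (t * (1 + ε)) / Real.log (1 + η) + 1) * (t : ℝ) ^ (-γ) =
        1 / Real.log (1 + η) * (Real.log t * (t : ℝ) ^ (-γ) + L * (t : ℝ) ^ (-γ)) := by
    intro t ht
    have ht0 : (t : ℝ) ≠ 0 := by
      have := (Finset.mem_Ico.mp ht).1
      exact_mod_cast (by omega : t ≠ 0)
    rw [Real.log_mul ht0 (by positivity), hL']
    field_simp
    ring
  rw [Finset.sum_congr rfl hterm, ← Finset.mul_sum, Finset.sum_add_distrib, ← Finset.mul_sum]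
  have h1 := sum_log_mul_rpow_neg_le hγ n
  have h2 : L * ∑ t ∈ Finset.Ico 2 n, (t : ℝ) ^ (-γ) ≤ 2 * (γ * L / (γ - 1)) := by
    calc _ ≤ L * (1 / (γ - 1)) := by gcongr; exact sum_rpow_neg_le hγ n
      _ = L / (γ - 1) := by ring
      _ ≤ 2 * γ * L / (γ - 1) := by gcongr; nlinarith
      _ = _ := by ring
  calc _ ≤ 1 / Real.log (1 + η) * (2 * (1 / (γ - 1) ^ 2 + 1) + 2 * (γ * L / (γ - 1))) := by
        gcongr
    _ = _ := by ring

end Expectation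

end CoopBandit

end

open CoopBandit in
theorem theorem3
    -- agents, arms and the connected communication graph
    {M N : ℕ} [NeZero M] (hMN : M ≤ N) (hN : 2 ≤ N)
    (G : SimpleGraph (Fin M)) [DecidableRel G.Adj] (hG : G.Connected)
    (κ : ℝ) (hκ0 : 0 < κ) (hκ1 : κ ≤ 1)
    (lam : Fin M → ℝ) (u : Fin M → Fin M → ℝ)
    (hmodal : CoopBandit.IsModalDecomposition (CoopBandit.consensusMatrix G κ) lam u)
    (hlam : ∀ p, -1 < lam p)
    -- the algorithm's parameters
    (θ : CoopBandit.Params) (hθ : θ.Admissible)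
    (tdag : Fin M → ℝ) (htdag_one : ∀ k, 1 ≤ tdag k)
    (htdag : ∀ k, θ.f (tdag k) = CoopBandit.epsC lam u k)
    -- the arms' sub-Gaussian reward distributions, with means `m (b 0) > m (b 1) > ⋯`
    (p : Fin N → Measure ℝ) [∀ i, IsProbabilityMeasure (p i)] (m : Fin N → ℝ)
    (hsub : ∀ i, CoopBandit.IsSubGaussian (p i) (m i) θ.σg)
    (b : Equiv.Perm (Fin N)) (hb : StrictAnti (fun n => m (b n)))
    -- rewards: at every time independent of the past and independent across the agents
    {Ω : Type*} {mΩ : MeasurableSpace Ω} (μ : Measure Ω) [IsProbabilityMeasure μ]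
    (ℱ : Filtration ℕ mΩ) (r : ℕ → Fin M → Fin N → Ω → ℝ)
    (hlaw : ∀ t k i, HasLaw (r (t + 1) k i) (p i) μ)
    (hadapted : ∀ t k i, Measurable[ℱ (t + 1)] (r (t + 1) k i))
    (hpast : ∀ t, Indep
      (MeasurableSpace.comap (fun ω k i => r (t + 1) k i ω) inferInstance) (ℱ t) μ)
    (hagents : ∀ t i, iIndepFun (fun k => r (t + 1) k i) μ)
    -- selections: made on the basis of the past, by coop-UCB2-selective-learning
    (arm : ℕ → Fin M → Ω → Fin N)
    (hprev : ∀ t k, Measurable[ℱ t] (arm (t + 1) k))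
    (halg : ∀ ω, CoopBandit.IsSelectiveLearning (CoopBandit.consensusMatrix G κ) θ
      (fun t k => arm t k ω) (fun t k i => r t k i ω))
    -- the arm and the time horizon
    (i : Fin N) (T : ℕ) (hT : 1 ≤ T) :
    ∑ k ∈ Finset.univ.filter (fun k : Fin M => b (Fin.castLE hMN k) ≠ i),
        ∫ ω, (CoopBandit.selections (fun t k => arm t k ω) i k T : ℝ) ∂μ
      ≤ 4 * θ.σg ^ 2 * θ.γ / (CoopBandit.gapMin m ^ 2 * θ.G) *
          (1 + Real.sqrt (1 + CoopBandit.gapMin m ^ 2 * M * θ.G / (2 * θ.σg ^ 2 * θ.γ) *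
            (θ.f T / Real.log T))) * Real.log T
        + CoopBandit.LBar M N θ (CoopBandit.epsN lam) tdag := by
  classical
  have hP := consensusMatrix_nonneg G hκ0 hκ1
  have hP1 := consensusMatrix_mulVec_one G (κ := κ)
  have habs : ∀ p, p ≠ 0 → |lam p| < 1 := fun p hp => hmodal.abs_lam_lt_one hG hκ0 hlam hp
  have hε := epsN_nonneg habs
  have hM0 : (0 : ℝ) < M := by exact_mod_cast Nat.pos_of_neZero M
  have harm : ∀ t k, Measurable (arm (t + 1) k) := fun t k => (hprev t k).mono (ℱ.le _) le_rfl
  have hr : ∀ t k i, Measurable (r (t + 1) k i) := fun t k i =>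
    (hadapted t k i).mono (ℱ.le _) le_rfl
  set P := consensusMatrix G κ
  set A := Finset.univ.filter (fun k : Fin M => b (Fin.castLE hMN k) ≠ i) with hA
  -- Deviations count only from `tdag k` on, where monotonicity of `f` gives `f t ≥ epsC` and the
  -- tail estimate applies.
  set D : Fin M → ℕ → Ω → ℝ := fun k t ω => if tdag k ≤ t then
    deviationCount P θ m (fun t k => arm t k ω) (fun t k i => r t k i ω)
      (b (Fin.castLE hMN k)) i t k else 0 with hD
  set w : ℕ → ℝ := fun t => (Real.log (t * (1 + epsN lam)) / Real.log (1 + θ.η) + 1) *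
    (t : ℝ) ^ (-θ.γ) with hw
  have hlogη : 0 < Real.log (1 + θ.η) := Real.log_pos (by linarith [hθ.η_pos])
  have hw0 : ∀ t, 2 ≤ t → 0 ≤ w t := by
    intro t ht
    have ht' : (2 : ℝ) ≤ t := by exact_mod_cast ht
    have : 0 ≤ Real.log (t * (1 + epsN lam)) := Real.log_nonneg (by nlinarith)
    simp only [hw]
    positivity
  have hDint : ∀ k, ∀ t ∈ Finset.Ico N T, Integrable (D k t) μ ∧
      ∫ ω, D k t ω ∂μ ≤ (N + 1) * w t := by
    intro k t ht
    have hNt := (Finset.mem_Ico.mp ht).1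
    by_cases hkt : tdag k ≤ t
    · simp only [hD, if_pos hkt]
      refine integral_deviationCount_le harm hr _ i t k fun s j hs => ?_
      refine hmodal.measure_deviation_le hP hP1 habs hMN hN hθ hsub hlaw hadapted hpast hagents
        hprev halg j hNt ?_ hs
      rw [← htdag]
      exact hθ.f_strictMono.monotoneOn (Set.mem_Ici.mpr (htdag_one k))
        (Set.mem_Ici.mpr ((htdag_one k).trans hkt)) hkt
    · simp only [hD, if_neg hkt]
      refine ⟨integrable_zero _ _ _, ?_⟩
      rw [integral_zero]
      exact mul_nonneg (by positivity) (hw0 t (hN.trans hNt))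
  have hpath : ∀ ω, ∑ k ∈ A, (selections (fun t k => arm t k ω) i k T : ℝ) ≤
      leadingTerm M θ m T + M * (1 + epsN lam) + ∑ k, (tdag k - 1) +
        ∑ k ∈ A, ∑ t ∈ Finset.Ico N T, D k t ω := fun ω =>
    (halg ω).sum_selections_le hmodal hP hP1 habs hMN hN hθ hb htdag_one i hT
  have hDsum : Integrable (fun ω => ∑ k ∈ A, ∑ t ∈ Finset.Ico N T, D k t ω) μ :=
    integrable_finsetSum _ fun k _ => integrable_finsetSum _ fun t ht => (hDint k t ht).1
  have hdev : ∑ k ∈ A, ∑ t ∈ Finset.Ico N T, ∫ ω, D k t ω ∂μ ≤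
      M * ((N + 1) * ∑ t ∈ Finset.Ico 2 T, w t) := by
    have hsum : (N + 1 : ℝ) * ∑ t ∈ Finset.Ico N T, w t ≤
        (N + 1) * ∑ t ∈ Finset.Ico 2 T, w t := by
      refine mul_le_mul_of_nonneg_left ?_ (by positivity)
      exact Finset.sum_le_sum_of_subset_of_nonneg (Finset.Ico_subset_Ico_left hN)
        fun t ht _ => hw0 t (Finset.mem_Ico.mp ht).1
    have hnonneg : 0 ≤ (N + 1 : ℝ) * ∑ t ∈ Finset.Ico 2 T, w t :=
      mul_nonneg (by positivity)
        (Finset.sum_nonneg fun t ht => hw0 t (Finset.mem_Ico.mp ht).1)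
    calc _ ≤ ∑ _k ∈ A, (N + 1 : ℝ) * ∑ t ∈ Finset.Ico 2 T, w t := by
          refine Finset.sum_le_sum fun k _ => le_trans ?_ hsum
          rw [Finset.mul_sum]
          exact Finset.sum_le_sum fun t ht => (hDint k t ht).2
      _ ≤ ∑ _k : Fin M, (N + 1 : ℝ) * ∑ t ∈ Finset.Ico 2 T, w t :=
          Finset.sum_le_sum_of_subset_of_nonneg (Finset.subset_univ _) fun _ _ _ => hnonneg
      _ = _ := by simp
  have htail := sum_tail_le hθ.one_lt_γ hθ.η_pos hε T
  have hmain : ∑ k ∈ A, ∫ ω, (selections (fun t k => arm t k ω) i k T : ℝ) ∂μ ≤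
      leadingTerm M θ m T + M * (1 + epsN lam) + ∑ k, (tdag k - 1) +
        ∑ k ∈ A, ∑ t ∈ Finset.Ico N T, ∫ ω, D k t ω ∂μ := by
    rw [← integral_finsetSum _ fun k _ => integrable_selections harm i k T]
    refine (integral_mono (integrable_finsetSum _ fun k _ => integrable_selections harm i k T)
      ((integrable_const _).add hDsum) hpath).trans (le_of_eq ?_)
    rw [integral_add' (integrable_const _) hDsum, integral_const,
      integral_finsetSum _ fun k _ => integrable_finsetSum _ fun t ht => (hDint k t ht).1]
    simp only [probReal_univ, one_smul]
    congr 1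
    exact Finset.sum_congr rfl fun k _ => integral_finsetSum _ fun t ht => (hDint k t ht).1
  have hfinal : M * ((N + 1) * ∑ t ∈ Finset.Ico 2 T, w t) ≤
      2 * M * (N + 1) / Real.log (1 + θ.η) * (1 / (θ.γ - 1) ^ 2 +
        θ.γ * Real.log ((1 + epsN lam) * (1 + θ.η)) / (θ.γ - 1) + 1) := by
    calc _ ≤ (M : ℝ) * ((N + 1) * (2 / Real.log (1 + θ.η) * (1 / (θ.γ - 1) ^ 2 +
        θ.γ * Real.log ((1 + epsN lam) * (1 + θ.η)) / (θ.γ - 1) + 1))) := by gcongr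
      _ = _ := by ring
  rw [leadingTerm] at hmain
  rw [LBar]
  -- The separate summand 1 in `LBar` is slack.
  linarith
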